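/- **Definitions.** A *Ricci flow spacetime* $(\mathcal M^{n+1},\mathfrak t,\partial_t,g)$ with time interval $I$ (an open interval of $\mathbb R$) consists of a smooth connected $(n+1)$-manifold $\mathcal M$ without boundary (Hausdorff and second countable), a smooth submersion $\mathfrak t:\mathcal M\to I$ onto $I$, a smooth vector field $\partial_t$ on $\mathcal M$ with $\partial_t(\mathfrak t)\equiv 1$, and a smooth inner product $g$ on the bundle $\ker(d\mathfrak t)$ which satisfies $\mathcal L_{\partial_t}g=-2\,\mathrm{Ric}(g)$, where $\mathrm{Ric}(g)$ is the Ricci tensor of the Riemannian metric $g(t)$ that $g$ induces on the time slice $\mathcal M_t=\mathfrak t^{-1}(t)$. The *worldline* of $x\in\mathcal M$ is the maximal integral curve $I_x\to\mathcal M$, $t\mapsto x(t)$, of $\partial_t$ with $x(\mathfrak t(x))=x$. A spacetime with $I=(0,T)$, $0<T\le\infty$, is *expanding* if $\sup I_x=T$ for all $x\in\mathcal M$. **Theorem.** Let $n\ge 0$ and let $(\mathcal M^{n+1},\mathfrak t,\partial_t,g)$ be an expanding Ricci flow spacetime with $I=(0,T)$. Then there exist a smooth connected $n$-manifold $M$ (Hausdorff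 and second countable) and a smooth map $\Phi:\mathcal M\to M\times(0,T)$ such that 1. $\Phi$ is a diffeomorphism onto its image, which is open in $M\times(0,T)$; 2. for each $t\in(0,T)$, the restriction $\Phi:\mathcal M_t\to M\times\{t\}$ is a diffeomorphism onto its image, which is open in $M\times\{t\}$; 3. if $t:M\times(0,T)\to(0,T)$ denotes the projection, then $\mathfrak t=t\circ\Phi$ and $\Phi_*(\partial_t)=\frac{\partial}{\partial t}$; 4. $\Phi_*(g)$ is a smooth family of Riemannian metrics $h(t)$ on the (open, nonempty) slices $\{p\in M:(p,t)\in\Phi(\mathcal M)\}$, $t\in(0,T)$, which solves the Ricci flow equation $\frac{\partial h}{\partial t}(t)=-2\,\mathrm{Ric}(h(t))$ at every point of $\Phi(\mathcal M)$; 5. $M$ is the direct limit of the time slices along the flow of $\partial_t$: writing $f$ for the first component of $\Phi$, one has $M=\bigcup_{t\in(0,T)}f(\mathcal M_t)$, and for $x,y\in\mathcal M$ one has $f(x)=f(y)$ if and only if $y=x(t)$ for some $t\in I_x$. -/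

import Mathlib

open Set Manifold
open scoped Manifold ContDiff Topology

universe u

noncomputable section

namespace RicciSpacetime

/-! ### Ricci curvature in local coordinates -/

/-- The partial derivative `∂f/∂xₖ` at `y`. -/
def pderiv {n : ℕ} (k : Fin n) (f : EuclideanSpace ℝ (Fin n) → ℝ)
    (y : EuclideanSpace ℝ (Fin n)) : ℝ :=
  fderiv ℝ f y (EuclideanSpace.single k 1)

/-- The Christoffel symbol `Γᵏᵢⱼ = ½ ∑ₗ gᵏˡ (∂ᵢ gⱼₗ + ∂ⱼ gᵢₗ - ∂ₗ gᵢⱼ)` of a metric given by the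
matrix of its coefficients. -/
def christoffel {n : ℕ} (G : EuclideanSpace ℝ (Fin n) → Matrix (Fin n) (Fin n) ℝ)
    (k i j : Fin n) (y : EuclideanSpace ℝ (Fin n)) : ℝ :=
  (1 / 2 : ℝ) * ∑ l, (G y)⁻¹ k l *
    (pderiv i (fun z => G z j l) y + pderiv j (fun z => G z i l) y
      - pderiv l (fun z => G z i j) y)

/-- The coefficients of the Ricci tensor in coordinates:
`Rᵢⱼ = ∑ₖ (∂ₖ Γᵏᵢⱼ - ∂ⱼ Γᵏᵢₖ) + ∑ₖₗ (Γᵏₖₗ Γˡᵢⱼ - Γᵏⱼₗ Γˡᵢₖ)`. -/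
def ricciCoeff {n : ℕ} (G : EuclideanSpace ℝ (Fin n) → Matrix (Fin n) (Fin n) ℝ)
    (y : EuclideanSpace ℝ (Fin n)) (i j : Fin n) : ℝ :=
  ∑ k, (pderiv k (christoffel G k i j) y - pderiv j (christoffel G k i k) y)
    + ∑ k, ∑ l, (christoffel G k k l y * christoffel G l i j y
      - christoffel G k j l y * christoffel G l i k y)

/-- The Ricci tensor at `y` of a metric with coefficients `G`, applied to two vectors. -/
def ricciCoord {n : ℕ} (G : EuclideanSpace ℝ (Fin n) → Matrix (Fin n) (Fin n) ℝ)
    (y a b : EuclideanSpace ℝ (Fin n)) : ℝ :=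
  ∑ i, ∑ j, a i * b j * ricciCoeff G y i j

/-! ### Smooth vector fields and diffeomorphisms onto open images -/

/-- The vector field `X` is smooth on the set `W`. -/
def SmoothFieldOn {m : ℕ} {N : Type u} [TopologicalSpace N]
    [ChartedSpace (EuclideanSpace ℝ (Fin m)) N] [IsManifold (𝓡 m) ∞ N]
    (X : ∀ p : N, TangentSpace (𝓡 m) p) (W : Set N) : Prop :=
  ContMDiffOn (𝓡 m) (𝓡 m).tangent ∞ (fun p => (⟨p, X p⟩ : TangentBundle (𝓡 m) N)) W

/-- The restriction of `f` to `s` is a diffeomorphism onto its image, which is open in the target.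
(When `s` is an embedded submanifold, a map into `s` is smooth if and only if it is smooth as a map
into the surrounding manifold.) -/
def IsDiffeoOntoOpenImageOn {E E' H H' : Type*} [NormedAddCommGroup E] [NormedSpace ℝ E]
    [NormedAddCommGroup E'] [NormedSpace ℝ E'] [TopologicalSpace H] [TopologicalSpace H']
    (I : ModelWithCorners ℝ E H) (J : ModelWithCorners ℝ E' H')
    {N N' : Type*} [TopologicalSpace N] [ChartedSpace H N]
    [TopologicalSpace N'] [ChartedSpace H' N'] (s : Set N) (f : N → N') : Prop :=
  ContMDiffOn I J ∞ f s ∧ IsOpen (f '' s) ∧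
    ∃ h : N' → N, ContMDiffOn J I ∞ h (f '' s) ∧ ∀ x ∈ s, h (f x) = x

/-! ### Ricci flow on an open subset of an ambient space `M × I` -/

section Ambient

variable {n : ℕ} {M : Type u} [TopologicalSpace M] [ChartedSpace (EuclideanSpace ℝ (Fin n)) M]

/-- The coefficients, in the chart of `M` around `p`, of a field `h` of bilinear forms. -/
def chartCoeff (h : ∀ p : M, LinearMap.BilinForm ℝ (TangentSpace (𝓡 n) p)) (p : M)
    (y : EuclideanSpace ℝ (Fin n)) : Matrix (Fin n) (Fin n) ℝ :=
  Matrix.of fun i j =>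
    h ((extChartAt (𝓡 n) p).symm y)
      (mfderiv (𝓡 n) (𝓡 n) (extChartAt (𝓡 n) p).symm y (EuclideanSpace.single i (1 : ℝ)))
      (mfderiv (𝓡 n) (𝓡 n) (extChartAt (𝓡 n) p).symm y (EuclideanSpace.single j (1 : ℝ)))

/-- The Ricci tensor at `p` of a Riemannian metric `h` defined near `p`. -/
def ricci (h : ∀ p : M, LinearMap.BilinForm ℝ (TangentSpace (𝓡 n) p)) (p : M)
    (v w : TangentSpace (𝓡 n) p) : ℝ :=
  ricciCoord (chartCoeff h p) (extChartAt (𝓡 n) p p)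
    (mfderiv (𝓡 n) (𝓡 n) (extChartAt (𝓡 n) p) p v)
    (mfderiv (𝓡 n) (𝓡 n) (extChartAt (𝓡 n) p) p w)

/-- `𝒰` is an open subset of `M × I` all of whose time slices are nonempty, and `h t` is a smooth
family of Riemannian metrics on the slices `{p | (p, t) ∈ 𝒰}` with `∂h/∂t = -2 Ric(h(t))` on `𝒰`.
The values of `h` off `𝒰` are irrelevant. -/
structure IsRicciFlowOn [IsManifold (𝓡 n) ∞ M] (I : Set ℝ) (𝒰 : Set (M × ℝ))
    (h : ℝ → ∀ p : M, LinearMap.BilinForm ℝ (TangentSpace (𝓡 n) p)) : Prop where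
  isOpen : IsOpen 𝒰
  subset : 𝒰 ⊆ univ ×ˢ I
  slice_nonempty : ∀ t ∈ I, ∃ p, (p, t) ∈ 𝒰
  symm : ∀ p t, (p, t) ∈ 𝒰 → ∀ v w, h t p v w = h t p w v
  pos : ∀ p t, (p, t) ∈ 𝒰 → ∀ v, v ≠ 0 → 0 < h t p v v
  smooth : ∀ (W : Set M) (X Y : ∀ p : M, TangentSpace (𝓡 n) p), IsOpen W →
    SmoothFieldOn X W → SmoothFieldOn Y W →
    ContMDiffOn ((𝓡 n).prod 𝓘(ℝ, ℝ)) 𝓘(ℝ, ℝ) ∞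
      (fun z : M × ℝ => h z.2 z.1 (X z.1) (Y z.1)) (𝒰 ∩ W ×ˢ univ)
  flow : ∀ p t, (p, t) ∈ 𝒰 → ∀ v w,
    HasDerivAt (fun s => h s p v w) (-2 * ricci (h t) p v w) t

end Ambient

/-! ### Ricci flow spacetimes -/

section Spacetime

variable {n : ℕ} {𝓜 : Type u} [TopologicalSpace 𝓜]
  [ChartedSpace (EuclideanSpace ℝ (Fin (n + 1))) 𝓜]

variable (n) in
/-- The space of spatial vectors `ker(d𝔱)` at `x`. -/
def spat (time : 𝓜 → ℝ) (x : 𝓜) : Submodule ℝ (TangentSpace (𝓡 (n + 1)) x) :=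
  LinearMap.ker (mvfderiv (𝓡 (n + 1)) time x : TangentSpace (𝓡 (n + 1)) x →ₗ[ℝ] ℝ)

variable (n 𝓜) in
/-- A time function, a time vector field and a spatial metric on a smooth `(n+1)`-manifold. -/
structure PreSpacetime [IsManifold (𝓡 (n + 1)) ∞ 𝓜] (I : Set ℝ) where
  /-- the time function `𝔱` -/
  time : 𝓜 → ℝ
  /-- the time vector field `∂_t` -/
  dt : ∀ x : 𝓜, TangentSpace (𝓡 (n + 1)) x
  /-- the inner product on `ker(d𝔱)` -/
  g : ∀ x : 𝓜, LinearMap.BilinForm ℝ (spat n time x)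
  isOpen_interval : IsOpen I
  ordConnected_interval : I.OrdConnected
  time_smooth : ContMDiff (𝓡 (n + 1)) 𝓘(ℝ, ℝ) ∞ time
  time_range : range time = I
  time_submersion : ∀ x, Function.Surjective (mvfderiv (𝓡 (n + 1)) time x)
  dt_smooth : SmoothFieldOn dt univ
  dt_time : ∀ x, mvfderiv (𝓡 (n + 1)) time x (dt x) = 1
  g_symm : ∀ x v w, g x v w = g x w v
  g_pos : ∀ x v, v ≠ 0 → 0 < g x v v
  g_smooth : ∀ (W : Set 𝓜) (X Y : ∀ x : 𝓜, spat n time x), IsOpen W →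
    SmoothFieldOn (fun x => (X x : TangentSpace (𝓡 (n + 1)) x)) W →
    SmoothFieldOn (fun x => (Y x : TangentSpace (𝓡 (n + 1)) x)) W →
    ContMDiffOn (𝓡 (n + 1)) 𝓘(ℝ, ℝ) ∞ (fun x => g x (X x) (Y x)) W

namespace PreSpacetime

variable [IsManifold (𝓡 (n + 1)) ∞ 𝓜] {I : Set ℝ} (S : PreSpacetime n 𝓜 I)

/-- The projection `v ↦ v - d𝔱(v) ∂_t` onto `ker(d𝔱)` along `∂_t`; it fixes spatial vectors. -/
def proj (x : 𝓜) (v : TangentSpace (𝓡 (n + 1)) x) : spat n S.time x :=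
  ⟨v - mvfderiv (𝓡 (n + 1)) S.time x v • S.dt x, by simp [spat, S.dt_time x]⟩

/-- The spatial inner product as a function of two tangent vectors of `𝓜`. It is only ever used on
spatial vectors, where it agrees with `g`. -/
def met (x : 𝓜) (v w : TangentSpace (𝓡 (n + 1)) x) : ℝ := S.g x (S.proj x v) (S.proj x w)

/-- The time slice `𝓜_t`. -/
def slice (t : ℝ) : Set 𝓜 := {x | S.time x = t}

/-- The Lie derivative of `g` along `∂_t` at `x`, on spatial vector fields:
`(ℒ_{∂_t} g)(X, Y) = ∂_t (g(X, Y)) - g([∂_t, X], Y) - g(X, [∂_t, Y])`. -/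
def lieDerivMetric (X Y : ∀ x : 𝓜, spat n S.time x) (x : 𝓜) : ℝ :=
  mvfderiv (𝓡 (n + 1)) (fun z => S.g z (X z) (Y z)) x (S.dt x)
    - S.met x (VectorField.mlieBracket (𝓡 (n + 1)) S.dt (fun z => (X z).1) x) (Y x).1
    - S.met x (X x).1 (VectorField.mlieBracket (𝓡 (n + 1)) S.dt (fun z => (Y z).1) x)

/-- `φ` is a local parametrization of the slice `𝓜_t` over the open set `V ⊆ ℝⁿ`: an immersion
into that `n`-dimensional slice. -/
structure IsSliceParam (t : ℝ) (V : Set (EuclideanSpace ℝ (Fin n)))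
    (φ : EuclideanSpace ℝ (Fin n) → 𝓜) : Prop where
  isOpen : IsOpen V
  smooth : ContMDiffOn (𝓡 n) (𝓡 (n + 1)) ∞ φ V
  mem_slice : ∀ y ∈ V, φ y ∈ S.slice t
  immersion : ∀ y ∈ V, Function.Injective (mfderiv (𝓡 n) (𝓡 (n + 1)) φ y)

/-- The coefficients of the metric of a slice in a local parametrization `φ`. -/
def paramCoeff (φ : EuclideanSpace ℝ (Fin n) → 𝓜) (y : EuclideanSpace ℝ (Fin n)) :
    Matrix (Fin n) (Fin n) ℝ :=
  Matrix.of fun i j =>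
    S.met (φ y) (mfderiv (𝓡 n) (𝓡 (n + 1)) φ y (EuclideanSpace.single i (1 : ℝ)))
      (mfderiv (𝓡 n) (𝓡 (n + 1)) φ y (EuclideanSpace.single j (1 : ℝ)))

/-- The equation `ℒ_{∂_t} g = -2 Ric(g)`, where `Ric(g)` is the Ricci tensor of the slices, computed
in local parametrizations of the slices. -/
def RicciFlowEquation : Prop :=
  ∀ (t : ℝ) (V : Set (EuclideanSpace ℝ (Fin n))) (φ : EuclideanSpace ℝ (Fin n) → 𝓜),
    S.IsSliceParam t V φ → ∀ y ∈ V, ∀ (W : Set 𝓜) (X Y : ∀ x : 𝓜, spat n S.time x),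
    IsOpen W → φ y ∈ W →
    SmoothFieldOn (fun x => (X x : TangentSpace (𝓡 (n + 1)) x)) W →
    SmoothFieldOn (fun x => (Y x : TangentSpace (𝓡 (n + 1)) x)) W →
    ∀ a b : EuclideanSpace ℝ (Fin n),
      mfderiv (𝓡 n) (𝓡 (n + 1)) φ y a = (X (φ y)).1 →
      mfderiv (𝓡 n) (𝓡 (n + 1)) φ y b = (Y (φ y)).1 →
      S.lieDerivMetric X Y (φ y) = -2 * ricciCoord (S.paramCoeff φ) y a b

/-- `y = x(t)`: the worldline of `x` (the maximal integral curve of `∂_t` with value `x` at time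
`𝔱(x)`) is defined at time `t` and takes the value `y` there. -/
def WorldlineAt (x : 𝓜) (t : ℝ) (y : 𝓜) : Prop :=
  ∃ (J : Set ℝ) (γ : ℝ → 𝓜), IsOpen J ∧ J.OrdConnected ∧ S.time x ∈ J ∧ t ∈ J ∧
    IsMIntegralCurveOn γ S.dt J ∧ γ (S.time x) = x ∧ γ t = y

/-- The domain `I_x` of the worldline of `x`. -/
def worldlineDomain (x : 𝓜) : Set ℝ := {t | ∃ y, S.WorldlineAt x t y}

/-- The vanishing time `T_x = sup I_x`, in the extended reals. -/
def vanishingTime (x : 𝓜) : EReal := sSup ((fun t : ℝ => (t : EReal)) '' S.worldlineDomain x)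

end PreSpacetime

variable (n 𝓜) in
/-- A Ricci flow spacetime with time interval `I` on the (connected) manifold `𝓜`. -/
structure RicciFlowSpacetime [IsManifold (𝓡 (n + 1)) ∞ 𝓜] (I : Set ℝ)
    extends PreSpacetime n 𝓜 I where
  ricciFlow : toPreSpacetime.RicciFlowEquation

end Spacetime

/-- The interval `(0, T)`, where `T = ∞` is allowed. -/
def timeInterval (T : EReal) : Set ℝ := {t : ℝ | 0 < t ∧ (t : EReal) < T}

/-- A spacetime with time interval `(0, T)` is expanding: every worldline lasts until time `T`. -/
def IsExpanding {n : ℕ} {𝓜 : Type u} [TopologicalSpace 𝓜]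
    [ChartedSpace (EuclideanSpace ℝ (Fin (n + 1))) 𝓜] [IsManifold (𝓡 (n + 1)) ∞ 𝓜] {T : EReal}
    (S : RicciFlowSpacetime n 𝓜 (timeInterval T)) : Prop :=
  ∀ x, S.vanishingTime x = T

end RicciSpacetime

end

noncomputable section

namespace RicciSpacetime

/-! ### Composition with a smooth map is smooth on spaces of continuous maps -/

section Postcomp

variable {K : Type*} [TopologicalSpace K] [CompactSpace K]

/-- Pointwise application of a continuous family of operators to a continuous family of vectors. -/
def applyCLM (K : Type*) [TopologicalSpace K] [CompactSpace K] (E F : Type*)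
    [NormedAddCommGroup E] [NormedSpace ℝ E] [NormedAddCommGroup F] [NormedSpace ℝ F] :
    C(K, E →L[ℝ] F) →L[ℝ] C(K, E) →L[ℝ] C(K, F) :=
  LinearMap.mkContinuous₂
    (LinearMap.mk₂ ℝ (fun (A : C(K, E →L[ℝ] F)) (h : C(K, E)) =>
        (⟨fun t => A t (h t), by fun_prop⟩ : C(K, F)))
      (fun _ _ _ => by ext; simp) (fun _ _ _ => by ext; simp)
      (fun _ _ _ => by ext; simp) (fun _ _ _ => by ext; simp)) 1
    (fun A h => by
      rw [one_mul]
      refine (ContinuousMap.norm_le _ (by positivity)).2 fun t => ?_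
      exact ((A t).le_opNorm (h t)).trans
        (mul_le_mul (A.norm_coe_le_norm t) (h.norm_coe_le_norm t) (norm_nonneg _) (norm_nonneg A)))

@[simp]
theorem applyCLM_apply {E F : Type*} [NormedAddCommGroup E] [NormedSpace ℝ E]
    [NormedAddCommGroup F] [NormedSpace ℝ F] (A : C(K, E →L[ℝ] F)) (h : C(K, E)) (t : K) :
    applyCLM K E F A h t = A t (h t) := rfl

theorem hasFDerivAt_postcomp {E F : Type*} [NormedAddCommGroup E] [NormedSpace ℝ E]
    [NormedAddCommGroup F] [NormedSpace ℝ F] (f : C(E, F)) (f' : C(E, E →L[ℝ] F))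
    (hf : ∀ x, HasFDerivAt f (f' x) x) (γ : C(K, E)) :
    HasFDerivAt (fun γ : C(K, E) => f.comp γ) (applyCLM K E F (f'.comp γ)) γ := by
  rw [hasFDerivAt_iff_isLittleO_nhds_zero, Asymptotics.isLittleO_iff]
  intro ε hε
  have hc : Continuous (fun γ : C(K, E) => f'.comp γ) := ContinuousMap.continuous_postcomp f'
  obtain ⟨δ, hδ, hd⟩ := Metric.continuousAt_iff (f := fun γ : C(K, E) => f'.comp γ) (a := γ)
    |>.1 hc.continuousAt ε hε
  filter_upwards [Metric.ball_mem_nhds (0 : C(K, E)) hδ] with h hh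
  rw [mem_ball_zero_iff] at hh
  refine (ContinuousMap.norm_le _ (by positivity)).2 fun t => ?_
  have key : ∀ y ∈ Metric.ball (γ t) δ, ‖f' y - f' (γ t)‖ ≤ ε := by
    intro y hy
    have h1 : dist (γ + ContinuousMap.const K (y - γ t)) γ < δ := by
      rw [dist_eq_norm, add_sub_cancel_left]
      refine (ContinuousMap.norm_lt_iff _ hδ).2 fun s => ?_
      simpa [dist_eq_norm] using hy
    have h2 := (ContinuousMap.dist_lt_iff hε).1 (hd h1) t
    rw [dist_eq_norm] at h2
    simpa using h2.le
  have hb : γ t + h t ∈ Metric.ball (γ t) δ := by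
    simpa [dist_eq_norm] using (h.norm_coe_le_norm t).trans_lt hh
  have := (convex_ball (γ t) δ).norm_image_sub_le_of_norm_hasFDerivWithin_le'
    (fun y _ => (hf y).hasFDerivWithinAt) key (Metric.mem_ball_self hδ) hb
  simp only [add_sub_cancel_left] at this
  simpa using this.trans (mul_le_mul_of_nonneg_left (h.norm_coe_le_norm t) hε.le)

theorem contDiff_postcomp_nat {E : Type u} [NormedAddCommGroup E] [NormedSpace ℝ E] (m : ℕ) :
    ∀ {F : Type u} [NormedAddCommGroup F] [NormedSpace ℝ F] (f : C(E, F)),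
      ContDiff ℝ ∞ f → ContDiff ℝ m (fun γ : C(K, E) => f.comp γ) := by
  induction m with
  | zero =>
    intro F _ _ f _
    exact contDiff_zero.2 (ContinuousMap.continuous_postcomp f)
  | succ m ih =>
    intro F _ _ f hf
    have hd : ContDiff ℝ ∞ (fderiv ℝ f) := hf.fderiv_right (by simp)
    let f' : C(E, E →L[ℝ] F) := ⟨fderiv ℝ f, hd.continuous⟩
    refine contDiff_succ_iff_hasFDerivAt.2
      ⟨fun γ => applyCLM K E F (f'.comp γ), ?_, ?_⟩
    · exact ContDiff.comp (g := applyCLM K E F) (ContinuousLinearMap.contDiff _) (ih f' hd)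
    · exact fun γ => hasFDerivAt_postcomp f f'
        (fun x => (hf.differentiable (by simp) x).hasFDerivAt) γ

/-- Composition with a smooth map is a smooth map between spaces of continuous maps. -/
theorem contDiff_postcomp {E F : Type u} [NormedAddCommGroup E] [NormedSpace ℝ E]
    [NormedAddCommGroup F] [NormedSpace ℝ F] (f : C(E, F)) (hf : ContDiff ℝ ∞ f) :
    ContDiff ℝ ∞ (fun γ : C(K, E) => f.comp γ) :=
  contDiff_infty.2 fun m => contDiff_postcomp_nat m f hf

end Postcomp

/-! ### The inverse function theorem for smooth maps, on a neighbourhood -/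

theorem exists_openPartialHomeomorph_of_contDiffOn {E F : Type*} [NormedAddCommGroup E]
    [NormedSpace ℝ E] [CompleteSpace E] [NormedAddCommGroup F] [NormedSpace ℝ F] [CompleteSpace F]
    {f : E → F} {U : Set E} (hU : IsOpen U) (hf : ContDiffOn ℝ ∞ f U) {a : E} (ha : a ∈ U)
    {f' : E ≃L[ℝ] F} (hf' : HasFDerivAt f (f' : E →L[ℝ] F) a) :
    ∃ e : OpenPartialHomeomorph E F, a ∈ e.source ∧ e.source ⊆ U ∧ (e : E → F) = f ∧
      ContDiffOn ℝ ∞ e.symm e.target := by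
  have hfa : ContDiffAt ℝ ∞ f a := hf.contDiffAt (hU.mem_nhds ha)
  let e₀ := hfa.toOpenPartialHomeomorph f hf' (by simp)
  let s : Set E := U ∩ fderiv ℝ f ⁻¹' range ((↑) : (E ≃L[ℝ] F) → E →L[ℝ] F)
  have hs : IsOpen s :=
    (hf.continuousOn_fderiv_of_isOpen hU (by simp)).isOpen_inter_preimage hU
      ContinuousLinearEquiv.isOpen
  refine ⟨e₀.restrOpen s hs, ?_, ?_, ?_, ?_⟩
  · refine ⟨hfa.mem_toOpenPartialHomeomorph_source hf' (by simp), ha, f', hf'.fderiv.symm⟩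
  · exact fun z hz => hz.2.1
  · rfl
  · intro y hy
    have hz := (e₀.restrOpen s hs).map_target hy
    obtain ⟨A, hA⟩ := hz.2.2
    refine ((e₀.restrOpen s hs).contDiffAt_symm (f₀' := A) hy ?_ ?_).contDiffWithinAt
    · rw [hA]
      exact ((hf.contDiffAt (hU.mem_nhds hz.2.1)).differentiableAt (by simp)).hasFDerivAt
    · exact hf.contDiffAt (hU.mem_nhds hz.2.1)

/-! ### Smooth dependence of local flows on the initial value -/

section Flow

variable {E : Type u} [NormedAddCommGroup E] [NormedSpace ℝ E]

/-- The primitive vanishing at `0` of a curve on `[0, 1]`. -/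
def primitiveCLM (E : Type*) [NormedAddCommGroup E] [NormedSpace ℝ E] :
    C(Icc (0 : ℝ) 1, E) →L[ℝ] C(Icc (0 : ℝ) 1, E) :=
  have hcont : ∀ γ : C(Icc (0 : ℝ) 1, E), Continuous fun τ => γ (projIcc 0 1 zero_le_one τ) :=
    fun γ => γ.continuous.comp continuous_projIcc
  LinearMap.mkContinuous
    { toFun := fun γ => ⟨fun t => ∫ τ in (0 : ℝ)..t, γ (projIcc 0 1 zero_le_one τ),
        (intervalIntegral.continuous_primitive
          (fun a b => (hcont γ).intervalIntegrable a b) 0).comp continuous_subtype_val⟩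
      map_add' := fun γ₁ γ₂ => by
        ext t
        exact intervalIntegral.integral_add ((hcont γ₁).intervalIntegrable _ _)
          ((hcont γ₂).intervalIntegrable _ _)
      map_smul' := fun c γ => by
        ext t
        exact intervalIntegral.integral_smul c _ } 1
    (fun γ => by
      rw [one_mul]
      refine (ContinuousMap.norm_le _ (norm_nonneg _)).2 fun t => ?_
      have := intervalIntegral.norm_integral_le_of_norm_le_const (a := 0) (b := (t : ℝ))
        (f := fun τ => γ (projIcc 0 1 zero_le_one τ)) (C := ‖γ‖)
        (fun τ _ => γ.norm_coe_le_norm _)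
      refine this.trans ?_
      rw [sub_zero, abs_of_nonneg t.2.1]
      exact mul_le_of_le_one_right (norm_nonneg _) t.2.2)

theorem primitiveCLM_apply (γ : C(Icc (0 : ℝ) 1, E)) (t : Icc (0 : ℝ) 1) :
    primitiveCLM E γ t = ∫ τ in (0 : ℝ)..t, γ (projIcc 0 1 zero_le_one τ) := rfl

/-- The map whose zeros in the second component are the solutions on `[0, 1]` of
`γ' = s v(γ)`, `γ(0) = x`. -/
def odeMap (v : C(E, E)) (q : (E × ℝ) × C(Icc (0 : ℝ) 1, E)) : (E × ℝ) × C(Icc (0 : ℝ) 1, E) :=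
  (q.1, q.2 - ContinuousLinearMap.const ℝ (Icc (0 : ℝ) 1) q.1.1
    - q.1.2 • primitiveCLM E (v.comp q.2))

theorem contDiff_odeMap {v : C(E, E)} (hv : ContDiff ℝ ∞ v) : ContDiff ℝ ∞ (odeMap v) := by
  have h2 : ContDiff ℝ ∞ fun q : (E × ℝ) × C(Icc (0 : ℝ) 1, E) => v.comp q.2 :=
    (contDiff_postcomp v hv).comp contDiff_snd
  unfold odeMap
  fun_prop

theorem hasFDerivAt_odeMap {v : C(E, E)} (hv : ContDiff ℝ ∞ v) (x : E) :
    ∃ A : ((E × ℝ) × C(Icc (0 : ℝ) 1, E)) ≃L[ℝ] ((E × ℝ) × C(Icc (0 : ℝ) 1, E)),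
      HasFDerivAt (odeMap v) (A : _ →L[ℝ] _) ((x, 0), ContinuousMap.const _ x) := by
  have h2 : ContDiff ℝ ∞ fun q : (E × ℝ) × C(Icc (0 : ℝ) 1, E) => v.comp q.2 :=
    (contDiff_postcomp v hv).comp contDiff_snd
  have h3 : ContDiff ℝ ∞ fun q : (E × ℝ) × C(Icc (0 : ℝ) 1, E) => primitiveCLM E (v.comp q.2) :=
    (primitiveCLM E).contDiff.comp h2
  set p₀ : (E × ℝ) × C(Icc (0 : ℝ) 1, E) := ((x, 0), ContinuousMap.const _ x)
  let B : E × ℝ →L[ℝ] C(Icc (0 : ℝ) 1, E) :=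
    -((ContinuousLinearMap.const ℝ (Icc (0 : ℝ) 1)).comp (ContinuousLinearMap.fst ℝ E ℝ))
      - (ContinuousLinearMap.snd ℝ E ℝ).smulRight (primitiveCLM E (v.comp p₀.2))
  refine ⟨(ContinuousLinearEquiv.refl ℝ (E × ℝ)).skewProd
    (ContinuousLinearEquiv.refl ℝ C(Icc (0 : ℝ) 1, E)) B, ?_⟩
  have h4 := (h3.differentiable (by simp) p₀).hasFDerivAt
  have h5 : HasFDerivAt (fun q : (E × ℝ) × C(Icc (0 : ℝ) 1, E) => q.1.2)
    ((ContinuousLinearMap.snd ℝ E ℝ).comp (ContinuousLinearMap.fst ℝ _ _)) p₀ :=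
    hasFDerivAt_snd.comp p₀ hasFDerivAt_fst
  have h6 : HasFDerivAt (fun q : (E × ℝ) × C(Icc (0 : ℝ) 1, E) =>
      ContinuousLinearMap.const ℝ (Icc (0 : ℝ) 1) q.1.1)
    ((ContinuousLinearMap.const ℝ (Icc (0 : ℝ) 1)).comp
      ((ContinuousLinearMap.fst ℝ E ℝ).comp (ContinuousLinearMap.fst ℝ _ _))) p₀ :=
    (ContinuousLinearMap.hasFDerivAt _).comp p₀ (hasFDerivAt_fst.comp p₀ hasFDerivAt_fst)
  refine (hasFDerivAt_fst.prodMk ((hasFDerivAt_snd.sub h6).sub (h5.smul h4))).congr_fderiv ?_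
  ext q
  all_goals simp [p₀, B, sub_eq_add_neg]

variable [CompleteSpace E]

/-- A smooth vector field has a smooth local flow. -/
theorem exists_contDiffOn_flow {v : E → E} (hv : ContDiff ℝ ∞ v) (x₀ : E) :
    ∃ α : E × ℝ → E, ∃ r > 0,
      ContDiffOn ℝ ∞ α (Metric.ball x₀ r ×ˢ Metric.ball 0 r) ∧
      (∀ x ∈ Metric.ball x₀ r, α (x, 0) = x) ∧
      ∀ x ∈ Metric.ball x₀ r, ∀ s ∈ Metric.ball (0 : ℝ) r,
        HasDerivAt (fun s => α (x, s)) (v (α (x, s))) s := by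
  let V : C(E, E) := ⟨v, hv.continuous⟩
  obtain ⟨A, hA⟩ := hasFDerivAt_odeMap (v := V) hv x₀
  obtain ⟨e, hae, -, he, hes⟩ := exists_openPartialHomeomorph_of_contDiffOn isOpen_univ
    (contDiff_odeMap (v := V) hv).contDiffOn (mem_univ _) hA
  obtain ⟨ε, hε, a, ρ, L, K, hρ, hpl⟩ :=
    IsPicardLindelof.of_contDiffAt_one (hv.contDiffAt.of_le (by simp) : ContDiffAt ℝ 1 v x₀)
  obtain ⟨α, hα, hαc⟩ := (hpl 0).exists_forall_mem_closedBall_eq_hasDerivWithinAt_continuousOn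
  simp only [zero_sub, zero_add] at hα hαc
  obtain ⟨η, hη, hηs⟩ := Metric.isOpen_iff.1 e.open_source _ hae
  have hca : ContinuousAt α (x₀, 0) := hαc.continuousAt
    (prod_mem_nhds (Metric.closedBall_mem_nhds _ hρ) (Icc_mem_nhds (by linarith) hε))
  have hα0 : α (x₀, 0) = x₀ := (hα x₀ (Metric.mem_closedBall_self hρ.le)).1
  obtain ⟨δ, hδ, hd⟩ := Metric.continuousAt_iff.1 hca (η / 2) (half_pos hη)
  rw [hα0] at hd
  obtain ⟨r, hr, hrρ, hrε, hrδ, hrη⟩ : ∃ r > 0, r ≤ (ρ : ℝ) ∧ r ≤ ε ∧ r ≤ δ ∧ r ≤ η :=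
    ⟨min (min ρ ε) (min δ η), by positivity, by simp, by simp, by simp, by simp⟩
  have hder : ∀ x ∈ Metric.ball x₀ r, ∀ s ∈ Metric.ball (0 : ℝ) r,
      HasDerivAt (fun s => α (x, s)) (v (α (x, s))) s := by
    intro x hx s hs
    rw [mem_ball_zero_iff, Real.norm_eq_abs, abs_lt] at hs
    exact ((hα x (Metric.ball_subset_closedBall (Metric.ball_subset_ball hrρ hx))).2 s
      ⟨by linarith, by linarith⟩).hasDerivAt (Icc_mem_nhds (by linarith) (by linarith))
  refine ⟨α, r, hr, ?_, fun x hx =>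
    (hα x (Metric.ball_subset_closedBall (Metric.ball_subset_ball hrρ hx))).1, hder⟩
  have key : ∀ q ∈ Metric.ball x₀ r ×ˢ Metric.ball (0 : ℝ) r,
      (q, (0 : C(Icc (0 : ℝ) 1, E))) ∈ e.target ∧
      α q = (e.symm (q, 0)).2 ⟨1, by simp⟩ := by
    rintro ⟨x, s⟩ ⟨hx, hs⟩
    have hst : ∀ t ∈ Icc (0 : ℝ) 1, s * t ∈ Metric.ball (0 : ℝ) r := by
      intro t ht
      rw [mem_ball_zero_iff] at hs ⊢
      rw [norm_mul, Real.norm_of_nonneg ht.1]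
      exact (mul_le_of_le_one_right (norm_nonneg _) ht.2).trans_lt hs
    have hcomp : ∀ t ∈ Icc (0 : ℝ) 1,
        HasDerivAt (fun t => α (x, s * t)) (s • v (α (x, s * t))) t := by
      intro t ht
      have h1 : HasDerivAt (fun t : ℝ => s * t) s t := by
        simpa using (hasDerivAt_id t).const_mul s
      exact (hder x hx _ (hst t ht)).scomp t h1
    let γ : C(Icc (0 : ℝ) 1, E) := ⟨fun t => α (x, s * t),
      continuous_iff_continuousAt.2 fun t =>
        ContinuousAt.comp (f := fun t : Icc (0 : ℝ) 1 => (t : ℝ)) (g := fun t => α (x, s * t))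
          (hcomp t t.2).continuousAt continuous_subtype_val.continuousAt⟩
    have hsrc : ((x, s), γ) ∈ e.source := by
      apply hηs
      rw [Metric.mem_ball, Prod.dist_eq, Prod.dist_eq, max_lt_iff, max_lt_iff]
      refine ⟨⟨lt_of_lt_of_le hx hrη, lt_of_lt_of_le hs hrη⟩, ?_⟩
      refine (ContinuousMap.dist_lt_iff hη).2 fun t => ?_
      refine (hd ?_).trans (half_lt_self hη)
      rw [Prod.dist_eq, max_lt_iff]
      exact ⟨lt_of_lt_of_le hx hrδ, lt_of_lt_of_le (hst t t.2) hrδ⟩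
    have hval : e ((x, s), γ) = ((x, s), 0) := by
      rw [he]
      refine Prod.ext rfl ?_
      ext t
      have hsub : ∀ τ ∈ uIcc (0 : ℝ) t, τ ∈ Icc (0 : ℝ) 1 := by
        intro τ hτ
        rw [uIcc_of_le t.2.1] at hτ
        exact ⟨hτ.1, hτ.2.trans t.2.2⟩
      have hint : ∫ τ in (0 : ℝ)..t, s • v (α (x, s * τ)) = α (x, s * t) - α (x, s * 0) := by
        refine intervalIntegral.integral_eq_sub_of_hasDerivAt (fun τ hτ => hcomp τ (hsub τ hτ)) ?_
        refine ContinuousOn.intervalIntegrable fun τ hτ => ?_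
        exact (hv.continuous.continuousAt.comp
          (hcomp τ (hsub τ hτ)).continuousAt).const_smul s |>.continuousWithinAt
      have hprim : primitiveCLM E (V.comp γ) t = ∫ τ in (0 : ℝ)..t, v (α (x, s * τ)) := by
        rw [primitiveCLM_apply]
        refine intervalIntegral.integral_congr fun τ hτ => ?_
        simp only [ContinuousMap.comp_apply, ContinuousMap.coe_mk, V, γ,
          projIcc_of_mem zero_le_one (hsub τ hτ)]
      rw [intervalIntegral.integral_smul, mul_zero,
        (hα x (Metric.ball_subset_closedBall (Metric.ball_subset_ball hrρ hx))).1] at hint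
      change γ t - x - s • primitiveCLM E (V.comp γ) t = 0
      rw [hprim, hint]
      exact sub_self _
    have htgt := e.map_source hsrc
    rw [hval] at htgt
    refine ⟨htgt, ?_⟩
    rw [← hval, e.left_inv hsrc]
    simp [γ]
  have hsm : ContDiffOn ℝ ∞ (fun q : E × ℝ => (e.symm (q, 0)).2 ⟨1, by simp⟩)
      (Metric.ball x₀ r ×ˢ Metric.ball (0 : ℝ) r) := by
    have h1 : ContDiffOn ℝ ∞ (fun q : E × ℝ => e.symm (q, 0))
        (Metric.ball x₀ r ×ˢ Metric.ball (0 : ℝ) r) :=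
      hes.comp (contDiff_id.prodMk contDiff_const).contDiffOn fun q hq => (key q hq).1
    exact (ContinuousMap.evalCLM ℝ (⟨1, by simp⟩ : Icc (0 : ℝ) 1)).contDiff.comp_contDiffOn h1.snd
  exact hsm.congr fun q hq => (key q hq).2

end Flow

end RicciSpacetime

end

noncomputable section

namespace RicciSpacetime

/-! ### Flow boxes in Euclidean space -/

theorem exists_contDiff_eqOn_ball {E F : Type*} [NormedAddCommGroup E] [NormedSpace ℝ E]
    [FiniteDimensional ℝ E] [NormedAddCommGroup F] [NormedSpace ℝ F] {U : Set E} (hU : IsOpen U)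
    {v : E → F} (hv : ContDiffOn ℝ ∞ v U) {x₀ : E} (hx₀ : x₀ ∈ U) :
    ∃ w : E → F, ContDiff ℝ ∞ w ∧ ∃ ρ > 0, Metric.ball x₀ ρ ⊆ U ∧ EqOn w v (Metric.ball x₀ ρ) := by
  obtain ⟨R, hR, hRU⟩ := Metric.nhds_basis_closedBall.mem_iff.1 (hU.mem_nhds hx₀)
  let χ : ContDiffBump x₀ := ⟨R / 2, R, half_pos hR, half_lt_self hR⟩
  refine ⟨fun z => χ z • v z, ?_, R / 2, half_pos hR, ?_, ?_⟩
  · refine contDiff_iff_contDiffAt.2 fun z => ?_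
    by_cases hz : z ∈ U
    · exact χ.contDiff.contDiffAt.smul (hv.contDiffAt (hU.mem_nhds hz))
    · have hz' : z ∈ (tsupport χ)ᶜ := fun h => hz (hRU (χ.tsupport_eq ▸ h))
      refine (contDiffAt_const (c := (0 : F))).congr_of_eventuallyEq ?_
      filter_upwards [(isClosed_tsupport χ).isOpen_compl.mem_nhds hz'] with y hy
      rw [image_eq_zero_of_notMem_tsupport hy, zero_smul]
  · exact (Metric.ball_subset_closedBall.trans
      (Metric.closedBall_subset_closedBall (half_le_self hR.le))).trans hRU
  · intro z hz
    change χ z • v z = v z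
    rw [χ.one_of_mem_closedBall (Metric.ball_subset_closedBall hz), one_smul]

/-- A linear splitting of `ℝⁿ⁺¹` as `ker ℓ ⊕ ℝ v`. -/
theorem exists_splitting {n : ℕ} (l : EuclideanSpace ℝ (Fin (n + 1)) →L[ℝ] ℝ)
    {v : EuclideanSpace ℝ (Fin (n + 1))} (hv : l v = 1) :
    ∃ (ι : EuclideanSpace ℝ (Fin n) →L[ℝ] EuclideanSpace ℝ (Fin (n + 1)))
      (A : (EuclideanSpace ℝ (Fin n) × ℝ) ≃L[ℝ] EuclideanSpace ℝ (Fin (n + 1))),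
      (∀ y, l (ι y) = 0) ∧ ∀ y t, A (y, t) = ι y + t • v := by
  have hsurj : Function.Surjective l := fun c => ⟨c • v, by simp [hv]⟩
  have hk : Module.finrank ℝ (LinearMap.ker (l : EuclideanSpace ℝ (Fin (n + 1)) →ₗ[ℝ] ℝ)) = n := by
    have h1 := LinearMap.finrank_range_add_finrank_ker (l : EuclideanSpace ℝ (Fin (n + 1)) →ₗ[ℝ] ℝ)
    rw [LinearMap.range_eq_top.2 hsurj, finrank_top, finrank_euclideanSpace_fin] at h1
    simp at h1
    omega
  let j : EuclideanSpace ℝ (Fin n) ≃ₗ[ℝ]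
      LinearMap.ker (l : EuclideanSpace ℝ (Fin (n + 1)) →ₗ[ℝ] ℝ) :=
    LinearEquiv.ofFinrankEq _ _ (by rw [finrank_euclideanSpace_fin, hk])
  let ι : EuclideanSpace ℝ (Fin n) →ₗ[ℝ] EuclideanSpace ℝ (Fin (n + 1)) :=
    (Submodule.subtype _).comp j.toLinearMap
  have hι : ∀ y, l (ι y) = 0 := fun y => (j y).2
  let B : (EuclideanSpace ℝ (Fin n) × ℝ) →ₗ[ℝ] EuclideanSpace ℝ (Fin (n + 1)) :=
    ι.coprod (LinearMap.toSpanSingleton ℝ _ v)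
  have hB : ∀ y t, B (y, t) = ι y + t • v := fun y t => by simp [B]
  have hinj : Function.Injective B := by
    rw [← LinearMap.ker_eq_bot, LinearMap.ker_eq_bot']
    rintro ⟨y, t⟩ h
    rw [hB] at h
    have ht : t = 0 := by simpa [hι, hv] using congrArg l h
    have hy : ι y = 0 := by simpa [ht] using h
    have hy' : y = 0 := j.injective (Subtype.ext (by rw [map_zero]; exact hy))
    rw [ht, hy']
    rfl
  refine ⟨LinearMap.toContinuousLinearMap ι,
    (LinearEquiv.ofInjectiveOfFinrankEq B hinj ?_).toContinuousLinearEquiv, hι, fun y t => ?_⟩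
  · simp
  · exact hB y t

/-- A smooth vector field along which a smooth function `τ` grows with unit speed can be
straightened, with `τ` as the last coordinate. -/
theorem exists_flowBox {n : ℕ} {U : Set (EuclideanSpace ℝ (Fin (n + 1)))} (hU : IsOpen U)
    {v : EuclideanSpace ℝ (Fin (n + 1)) → EuclideanSpace ℝ (Fin (n + 1))}
    (hv : ContDiffOn ℝ ∞ v U) {τ : EuclideanSpace ℝ (Fin (n + 1)) → ℝ} (hτ : ContDiffOn ℝ ∞ τ U)
    (hvτ : ∀ z ∈ U, fderiv ℝ τ z (v z) = 1) {x₀ : EuclideanSpace ℝ (Fin (n + 1))} (hx₀ : x₀ ∈ U) :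
    ∃ (e : OpenPartialHomeomorph (EuclideanSpace ℝ (Fin (n + 1))) (EuclideanSpace ℝ (Fin n) × ℝ)),
      x₀ ∈ e.source ∧ e.source ⊆ U ∧ (∃ r, e.target = Metric.ball (e x₀) r) ∧
      ContDiffOn ℝ ∞ e e.source ∧ ContDiffOn ℝ ∞ e.symm e.target ∧
      (∀ z ∈ e.source, (e z).2 = τ z) ∧
      ∀ q ∈ e.target, HasDerivAt (fun s => e.symm (q.1, s)) (v (e.symm q)) q.2 := by
  obtain ⟨w, hw, ρ, hρ, hρU, hwv⟩ := exists_contDiff_eqOn_ball hU hv hx₀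
  obtain ⟨α, r, hr, hα, hα0, hαd⟩ := exists_contDiffOn_flow hw x₀
  obtain ⟨ι, A, hι, hA⟩ := exists_splitting (fderiv ℝ τ x₀) (hvτ x₀ hx₀)
  have hτd : ∀ z ∈ U, HasFDerivAt τ (fderiv ℝ τ z) z := fun z hz =>
    ((hτ.contDiffAt (hU.mem_nhds hz)).differentiableAt (by simp)).hasFDerivAt
  let t₀ := τ x₀
  -- the starting point of the integral curve
  let b : EuclideanSpace ℝ (Fin n) × ℝ → EuclideanSpace ℝ (Fin (n + 1)) := fun q => x₀ + ι q.1
  have hb : ContDiff ℝ ∞ b := by fun_prop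
  let q₀ : EuclideanSpace ℝ (Fin n) × ℝ := (0, t₀)
  have hb0 : b q₀ = x₀ := by simp [b, q₀]
  let a : EuclideanSpace ℝ (Fin n) × ℝ → EuclideanSpace ℝ (Fin (n + 1)) × ℝ :=
    fun q => (b q, q.2 - τ (b q))
  have ha0 : a q₀ = (x₀, 0) := by simp [a, hb0, q₀, t₀]
  let O₁ : Set (EuclideanSpace ℝ (Fin n) × ℝ) := b ⁻¹' (Metric.ball x₀ r ∩ U)
  have hO₁ : IsOpen O₁ := (Metric.isOpen_ball.inter hU).preimage hb.continuous
  have ha : ContDiffOn ℝ ∞ a O₁ :=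
    hb.contDiffOn.prodMk (contDiff_snd.contDiffOn.sub (hτ.comp hb.contDiffOn fun q hq => hq.2))
  let O₂ : Set (EuclideanSpace ℝ (Fin n) × ℝ) :=
    O₁ ∩ a ⁻¹' (Metric.ball x₀ r ×ˢ Metric.ball 0 r)
  have hO₂ : IsOpen O₂ := ha.continuousOn.isOpen_inter_preimage hO₁
    (Metric.isOpen_ball.prod Metric.isOpen_ball)
  let ψ : EuclideanSpace ℝ (Fin n) × ℝ → EuclideanSpace ℝ (Fin (n + 1)) := fun q => α (a q)
  have hψ : ContDiffOn ℝ ∞ ψ O₂ := hα.comp (ha.mono inter_subset_left) fun q hq => hq.2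
  have hψ0 : ψ q₀ = x₀ := by
    change α (a q₀) = x₀
    rw [ha0, hα0 x₀ (Metric.mem_ball_self hr)]
  let O₃ : Set (EuclideanSpace ℝ (Fin n) × ℝ) := O₂ ∩ ψ ⁻¹' Metric.ball x₀ ρ
  have hO₃ : IsOpen O₃ := hψ.continuousOn.isOpen_inter_preimage hO₂ Metric.isOpen_ball
  have hq₀₁ : q₀ ∈ O₁ := by
    rw [mem_preimage, hb0]
    exact ⟨Metric.mem_ball_self hr, hx₀⟩
  have hq₀₂ : q₀ ∈ O₂ := by
    refine ⟨hq₀₁, ?_⟩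
    rw [mem_preimage, ha0]
    exact ⟨Metric.mem_ball_self hr, Metric.mem_ball_self hr⟩
  have hq₀ : q₀ ∈ O₃ := by
    refine ⟨hq₀₂, ?_⟩
    rw [mem_preimage, hψ0]
    exact Metric.mem_ball_self hρ
  obtain ⟨ε, hε, hεO⟩ := Metric.isOpen_iff.1 hO₃ q₀ hq₀
  let O₄ : Set (EuclideanSpace ℝ (Fin n) × ℝ) :=
    Metric.ball q₀ ε ∩ (fun q => τ (b q)) ⁻¹' Metric.ball t₀ ε
  have hO₄ : IsOpen O₄ := by
    refine ContinuousOn.isOpen_inter_preimage ?_ Metric.isOpen_ball Metric.isOpen_ball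
    exact (hτ.comp (s := O₁) hb.contDiffOn fun q hq => hq.2).continuousOn.mono
      fun q hq => (hεO hq).1.1
  have hq₀₄ : q₀ ∈ O₄ := by
    refine ⟨Metric.mem_ball_self hε, ?_⟩
    rw [mem_preimage, hb0]
    exact Metric.mem_ball_self hε
  have hψd : ∀ q ∈ O₃, HasDerivAt (fun s => ψ (q.1, s)) (v (ψ q)) q.2 := by
    rintro ⟨y, t⟩ hq
    have h1 := hαd _ hq.1.2.1 _ hq.1.2.2
    rw [hwv (show α (b (y, t), t - τ (b (y, t))) ∈ Metric.ball x₀ ρ from hq.2)] at h1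
    exact HasDerivAt.comp_sub_const t _ h1
  have hτψ : ∀ q ∈ O₄, τ (ψ q) = q.2 := by
    rintro ⟨y, t⟩ hq
    have hmem : ∀ s ∈ Metric.ball t₀ ε, (y, s) ∈ O₃ := by
      intro s hs
      apply hεO
      have := hq.1
      rw [Metric.mem_ball, Prod.dist_eq, max_lt_iff] at this ⊢
      exact ⟨this.1, hs⟩
    have hder : ∀ s ∈ Metric.ball t₀ ε,
        HasDerivAt (fun s => τ (ψ (y, s)) - s) 0 s := by
      intro s hs
      have hU' : ψ (y, s) ∈ U := hρU (hmem s hs).2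
      have h1 := (hτd _ hU').comp_hasDerivAt s (hψd (y, s) (hmem s hs))
      rw [hvτ _ hU'] at h1
      exact (h1.sub (hasDerivAt_id s)).congr_deriv (sub_self 1)
    have hconst := Metric.isOpen_ball.is_const_of_deriv_eq_zero
      (convex_ball t₀ ε).isPreconnected
      (fun s hs => (hder s hs).differentiableAt.differentiableWithinAt)
      (fun s hs => (hder s hs).deriv) (show τ (b (y, t)) ∈ _ from hq.2)
      (show t ∈ Metric.ball t₀ ε by
        have := hq.1
        rw [Metric.mem_ball, Prod.dist_eq, max_lt_iff] at this
        exact this.2)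
    have hstart : ψ (y, τ (b (y, t))) = b (y, t) := by
      change α (b (y, t), τ (b (y, t)) - τ (b (y, t))) = _
      rw [sub_self]
      exact hα0 _ (hεO hq.1).1.1.1
    simp only [hstart, sub_self] at hconst
    linarith
  have hψ' : HasFDerivAt ψ (A : _ →L[ℝ] _) q₀ := by
    have hnh : Metric.ball x₀ r ×ˢ Metric.ball (0 : ℝ) r ∈ 𝓝 (x₀, (0 : ℝ)) :=
      prod_mem_nhds (Metric.ball_mem_nhds _ hr) (Metric.ball_mem_nhds _ hr)
    have hD : HasFDerivAt α (fderiv ℝ α (x₀, 0)) (x₀, 0) :=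
      ((hα.contDiffAt hnh).differentiableAt (by simp)).hasFDerivAt
    have hDx : ∀ u, fderiv ℝ α (x₀, 0) (u, 0) = u := by
      intro u
      have h1 : HasFDerivAt (fun x => α (x, 0))
          ((fderiv ℝ α (x₀, 0)).comp (ContinuousLinearMap.inl ℝ _ ℝ)) x₀ :=
        HasFDerivAt.comp (f := fun x => (x, (0 : ℝ))) x₀ hD (hasFDerivAt_prodMk_left x₀ 0)
      have h2 : HasFDerivAt (fun x => α (x, 0)) (ContinuousLinearMap.id ℝ _) x₀ :=
        (hasFDerivAt_id x₀).congr_of_eventuallyEq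
          (Filter.eventually_of_mem (Metric.ball_mem_nhds _ hr) hα0)
      simpa using DFunLike.congr_fun (h1.unique h2) u
    have hDt : fderiv ℝ α (x₀, 0) (0, 1) = v x₀ := by
      have h1 : HasDerivAt (fun s => α (x₀, s)) (fderiv ℝ α (x₀, 0) (0, 1)) 0 :=
        HasFDerivAt.comp_hasDerivAt (f := fun s : ℝ => (x₀, s)) 0 hD
          ((hasDerivAt_const _ _).prodMk (hasDerivAt_id _))
      have h2 := hαd x₀ (Metric.mem_ball_self hr) 0 (Metric.mem_ball_self hr)
      rw [hα0 x₀ (Metric.mem_ball_self hr), hwv (Metric.mem_ball_self hρ)] at h2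
      exact h1.unique h2
    have hbd : HasFDerivAt b (ι.comp (ContinuousLinearMap.fst ℝ _ ℝ)) q₀ :=
      (ι.comp (ContinuousLinearMap.fst ℝ _ ℝ)).hasFDerivAt.const_add x₀
    have hτd₀ : HasFDerivAt τ (fderiv ℝ τ x₀) (b q₀) := by
      rw [hb0]
      exact hτd x₀ hx₀
    have had : HasFDerivAt a _ q₀ := hbd.prodMk (hasFDerivAt_snd.sub (hτd₀.comp q₀ hbd))
    have hD' : HasFDerivAt α (fderiv ℝ α (x₀, 0)) (a q₀) := by
      rw [ha0]
      exact hD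
    refine (hD'.comp q₀ had).congr_fderiv ?_
    refine ContinuousLinearMap.ext fun q => ?_
    have hsplit : fderiv ℝ α (x₀, 0) (ι q.1, q.2) = ι q.1 + q.2 • v x₀ := by
      have : ((ι q.1, q.2) : EuclideanSpace ℝ (Fin (n + 1)) × ℝ)
          = (ι q.1, 0) + q.2 • ((0 : EuclideanSpace ℝ (Fin (n + 1))), (1 : ℝ)) := by simp
      rw [this, map_add, map_smul, hDx, hDt]
    simpa [hι, hsplit] using (hA q.1 q.2).symm
  obtain ⟨e, hqe, heO, heψ, hes⟩ := exists_openPartialHomeomorph_of_contDiffOn hO₄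
    (hψ.mono fun q hq => (hεO hq.1).1) hq₀₄ hψ'
  obtain ⟨R, hR, hRe⟩ := Metric.isOpen_iff.1 e.open_source q₀ hqe
  let e' := e.restrOpen (Metric.ball q₀ R) Metric.isOpen_ball
  have he's : e'.source = Metric.ball q₀ R := by
    rw [OpenPartialHomeomorph.restrOpen_source]
    exact inter_eq_right.2 hRe
  have he'ψ : (e' : _ → _) = ψ := heψ
  have hq₀' : q₀ ∈ e'.source := by
    rw [he's]
    exact Metric.mem_ball_self hR
  have hx₀' : x₀ = e' q₀ := by rw [he'ψ, hψ0]
  have hsub : ∀ q ∈ e'.source, q ∈ O₄ := fun q hq => heO hq.1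
  refine ⟨e'.symm, ?_, ?_, ⟨R, ?_⟩, ?_, ?_, ?_, ?_⟩
  · rw [hx₀']
    exact e'.map_source hq₀'
  · intro z hz
    have h1 := e'.map_target hz
    rw [← e'.right_inv hz, he'ψ]
    exact hρU (hεO (hsub _ h1).1).2
  · change e'.source = _
    rw [hx₀', e'.left_inv hq₀', he's]
  · exact hes.mono fun z hz => hz.1
  · change ContDiffOn ℝ ∞ e' e'.source
    rw [he'ψ]
    exact hψ.mono fun q hq => (hεO (hsub q hq).1).1
  · intro z hz
    have h1 := e'.map_target hz
    conv_rhs => rw [← e'.right_inv hz, he'ψ]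
    exact (hτψ _ (hsub _ h1)).symm
  · intro q hq
    change HasDerivAt (fun s => e' (q.1, s)) (v (e' q)) q.2
    rw [he'ψ]
    exact hψd q (hεO (hsub q hq).1)

end RicciSpacetime

end

noncomputable section

namespace RicciSpacetime

variable {n : ℕ} {𝓜 : Type u} [TopologicalSpace 𝓜]
  [ChartedSpace (EuclideanSpace ℝ (Fin (n + 1))) 𝓜]

/-! ### Derivatives along integral curves -/

theorem hasDerivAt_comp_of_hasMFDerivAt {F : Type*} [NormedAddCommGroup F] [NormedSpace ℝ F]
    {f : 𝓜 → F} {γ : ℝ → 𝓜} {s : ℝ} {v : TangentSpace (𝓡 (n + 1)) (γ s)}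
    (hf : MDifferentiableAt (𝓡 (n + 1)) 𝓘(ℝ, F) f (γ s))
    (hγ : HasMFDerivAt 𝓘(ℝ, ℝ) (𝓡 (n + 1)) γ s ((1 : ℝ →L[ℝ] ℝ).smulRight v)) :
    HasDerivAt (f ∘ γ) (mvfderiv (𝓡 (n + 1)) f (γ s) v) s := by
  let A : ℝ →L[ℝ] F := (mfderiv (𝓡 (n + 1)) 𝓘(ℝ, F) f (γ s)).comp ((1 : ℝ →L[ℝ] ℝ).smulRight v)
  have h1 : HasFDerivAt (f ∘ γ) A s := (hf.hasMFDerivAt.comp s hγ).hasFDerivAt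
  refine h1.hasDerivAt.congr_deriv ?_
  change mfderiv (𝓡 (n + 1)) 𝓘(ℝ, F) f (γ s) ((1 : ℝ) • v) = _
  rw [one_smul]
  rfl

namespace PreSpacetime

variable [IsManifold (𝓡 (n + 1)) ∞ 𝓜] {I : Set ℝ} (S : PreSpacetime n 𝓜 I)

/-- A flow box: smooth coordinates `(y, t)` on an open subset of `𝓜`, onto a ball, in which `t` is
the time function and the coordinate curves `s ↦ (y, s)` are worldlines. -/
structure IsFlowBox (F : OpenPartialHomeomorph 𝓜 (EuclideanSpace ℝ (Fin n) × ℝ)) : Prop where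
  contMDiffOn : ContMDiffOn (𝓡 (n + 1)) 𝓘(ℝ, EuclideanSpace ℝ (Fin n) × ℝ) ∞ F F.source
  contMDiffOn_symm : ContMDiffOn 𝓘(ℝ, EuclideanSpace ℝ (Fin n) × ℝ) (𝓡 (n + 1)) ∞ F.symm F.target
  snd_eq : ∀ z ∈ F.source, (F z).2 = S.time z
  hasMFDerivAt : ∀ q ∈ F.target, HasMFDerivAt 𝓘(ℝ, ℝ) (𝓡 (n + 1)) (fun s => F.symm (q.1, s)) q.2
    ((1 : ℝ →L[ℝ] ℝ).smulRight (S.dt (F.symm q)))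
  target_eq : ∃ c r, F.target = Metric.ball c r

theorem exists_isFlowBox (x : 𝓜) : ∃ F, x ∈ F.source ∧ S.IsFlowBox F := by
  let c := extChartAt (𝓡 (n + 1)) x
  have hc : c.target = (chartAt (EuclideanSpace ℝ (Fin (n + 1))) x).target := by
    simp [c, mfld_simps]
  have hopen : IsOpen c.target := isOpen_extChartAt_target x
  have hcs : ContMDiffOn (𝓡 (n + 1)) (𝓡 (n + 1)) ∞ c.symm c.target := contMDiffOn_extChartAt_symm x
  have hcsAt : ∀ z ∈ c.target, ContMDiffAt (𝓡 (n + 1)) (𝓡 (n + 1)) ∞ c.symm z :=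
    fun z hz => hcs.contMDiffAt (hopen.mem_nhds hz)
  let v : EuclideanSpace ℝ (Fin (n + 1)) → EuclideanSpace ℝ (Fin (n + 1)) :=
    VectorField.mpullback (𝓡 (n + 1)) (𝓡 (n + 1)) c.symm S.dt
  have hinv : ∀ z ∈ c.target, (mfderiv (𝓡 (n + 1)) (𝓡 (n + 1)) c.symm z).IsInvertible := by
    intro z hz
    have := isInvertible_mfderivWithin_extChartAt_symm (I := 𝓡 (n + 1)) hz
    rwa [ModelWithCorners.range_eq_univ, mfderivWithin_univ] at this
  have hvdt : ∀ z ∈ c.target,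
      mfderiv (𝓡 (n + 1)) (𝓡 (n + 1)) c.symm z (v z) = S.dt (c.symm z) := by
    intro z hz
    exact (hinv z hz).self_apply_inverse _
  have hv : ContDiffOn ℝ ∞ v c.target := by
    intro z hz
    have h1 : ContMDiffAt (𝓡 (n + 1)) (𝓡 (n + 1)).tangent ∞
        (fun p => (⟨p, S.dt p⟩ : TangentBundle (𝓡 (n + 1)) 𝓜)) (c.symm z) :=
      S.dt_smooth.contMDiffAt Filter.univ_mem
    have h2 := ContMDiffAt.mpullback_vectorField_preimage h1 (hcsAt z hz) (hinv z hz) (by simp)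
    exact (contMDiffAt_vectorSpace_iff_contDiffAt.1 h2).contDiffWithinAt
  let τ : EuclideanSpace ℝ (Fin (n + 1)) → ℝ := S.time ∘ c.symm
  have hτ : ContDiffOn ℝ ∞ τ c.target :=
    (S.time_smooth.comp_contMDiffOn hcs).contDiffOn
  have hvτ : ∀ z ∈ c.target, fderiv ℝ τ z (v z) = 1 := by
    intro z hz
    rw [← S.dt_time (c.symm z), ← hvdt z hz]
    have := mfderiv_comp z (S.time_smooth.mdifferentiableAt (by simp) (x := c.symm z))
      ((hcsAt z hz).mdifferentiableAt (by simp))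
    rw [mfderiv_eq_fderiv] at this
    exact DFunLike.congr_fun this (v z)
  obtain ⟨e, hxe, heU, ⟨r, her⟩, he, hes, hτe, hd⟩ := exists_flowBox hopen hv hτ hvτ
    (mem_extChartAt_target (I := 𝓡 (n + 1)) x)
  let F := (chartAt (EuclideanSpace ℝ (Fin (n + 1))) x).trans e
  have hFt : F.target = e.target := by
    rw [OpenPartialHomeomorph.trans_target]
    exact inter_eq_left.2 fun q hq => hc ▸ heU (e.map_target hq)
  have hFs : ∀ z ∈ F.source, z ∈ c.source ∧ c z ∈ e.source := by
    intro z hz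
    rw [OpenPartialHomeomorph.trans_source] at hz
    exact ⟨by rw [extChartAt_source]; exact hz.1, hz.2⟩
  refine ⟨F, ?_, ?_, ?_, ?_, ?_, ⟨e (c x), r, ?_⟩⟩
  · rw [OpenPartialHomeomorph.trans_source]
    exact ⟨mem_chart_source _ x, hxe⟩
  · refine (he.contMDiffOn).comp
      ((contMDiffOn_extChartAt (I := 𝓡 (n + 1)) (n := ∞) (x := x)).mono fun z hz => ?_)
      fun z hz => (hFs z hz).2
    simpa [c] using (hFs z hz).1
  · rw [hFt]
    exact hcs.comp hes.contMDiffOn fun q hq => heU (e.map_target hq)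
  · intro z hz
    have := hτe (c z) (hFs z hz).2
    rw [show τ (c z) = S.time z from congrArg S.time (c.left_inv (hFs z hz).1)] at this
    exact this
  · intro q hq
    rw [hFt] at hq
    have hq' : e.symm q ∈ c.target := heU (e.map_target hq)
    have h1 := ((hcsAt _ hq').mdifferentiableAt (by simp)).hasMFDerivAt
    have h2 : HasMFDerivAt 𝓘(ℝ, ℝ) (𝓡 (n + 1)) (fun s => e.symm (q.1, s)) q.2 _ :=
      (hd q hq).hasFDerivAt.hasMFDerivAt
    refine (HasMFDerivAt.comp (f := fun s => e.symm (q.1, s)) q.2 h1 h2).congr_mfderiv ?_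
    ext1
    change mfderiv (𝓡 (n + 1)) (𝓡 (n + 1)) c.symm (e.symm q) ((1 : ℝ) • v (e.symm q))
      = (1 : ℝ) • S.dt (c.symm (e.symm q))
    rw [one_smul, one_smul, hvdt _ hq']
  · rw [hFt, her]

end PreSpacetime

end RicciSpacetime

end

noncomputable section

namespace RicciSpacetime

/-! ### Worldlines -/

theorem exists_Ioo_subset {J : Set ℝ} (hJ : IsOpen J) (hJ' : J.OrdConnected) {a b : ℝ}
    (ha : a ∈ J) (hb : b ∈ J) : ∃ l u, a ∈ Ioo l u ∧ b ∈ Ioo l u ∧ Ioo l u ⊆ J := by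
  have key : ∀ c ∈ J, ∃ ε > 0, c - ε ∈ J ∧ c + ε ∈ J := by
    intro c hc
    obtain ⟨ε, hε, h⟩ := Metric.isOpen_iff.1 hJ c hc
    refine ⟨ε / 2, half_pos hε, h ?_, h ?_⟩ <;>
    · rw [Metric.mem_ball, Real.dist_eq]
      simp [abs_of_pos (half_pos hε), half_lt_self hε]
  obtain ⟨ε, hε, h1, -⟩ := key (min a b) (by rcases min_choice a b with h | h <;> rwa [h])
  obtain ⟨δ, hδ, -, h2⟩ := key (max a b) (by rcases max_choice a b with h | h <;> rwa [h])
  refine ⟨min a b - ε, max a b + δ, ?_, ?_, fun s hs => hJ'.out h1 h2 ⟨hs.1.le, hs.2.le⟩⟩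
  · exact ⟨by linarith [min_le_left a b], by linarith [le_max_left a b]⟩
  · exact ⟨by linarith [min_le_right a b], by linarith [le_max_right a b]⟩

namespace PreSpacetime

variable {n : ℕ} {𝓜 : Type u} [TopologicalSpace 𝓜]
  [ChartedSpace (EuclideanSpace ℝ (Fin (n + 1))) 𝓜] [IsManifold (𝓡 (n + 1)) ∞ 𝓜]
  {I : Set ℝ} (S : PreSpacetime n 𝓜 I)

theorem time_mem (x : 𝓜) : S.time x ∈ I := S.time_range.subset (mem_range_self x)

theorem time_curve {J : Set ℝ} (hJ : IsOpen J) (hJ' : J.OrdConnected) {γ : ℝ → 𝓜}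
    (hγ : IsMIntegralCurveOn γ S.dt J) {t₀ : ℝ} (ht₀ : t₀ ∈ J) (h : S.time (γ t₀) = t₀) :
    ∀ t ∈ J, S.time (γ t) = t := by
  have hder : ∀ s ∈ J, HasDerivAt (fun s => S.time (γ s) - s) 0 s := by
    intro s hs
    have h1 := hasDerivAt_comp_of_hasMFDerivAt
      (S.time_smooth.mdifferentiableAt (by simp) (x := γ s))
      ((hγ s hs).hasMFDerivAt (hJ.mem_nhds hs))
    rw [S.dt_time] at h1
    exact (h1.sub (hasDerivAt_id s)).congr_deriv (sub_self 1)
  intro t ht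
  have := hJ.is_const_of_deriv_eq_zero hJ'.isPreconnected
    (fun s hs => (hder s hs).differentiableAt.differentiableWithinAt)
    (fun s hs => (hder s hs).deriv) ht ht₀
  simp only [h] at this
  linarith

/-- Two points lie on a common worldline. -/
def Rel (x y : 𝓜) : Prop := ∃ t, S.WorldlineAt x t y

theorem WorldlineAt.time_eq {S : PreSpacetime n 𝓜 I} {x y : 𝓜} {t : ℝ} (h : S.WorldlineAt x t y) :
    S.time y = t := by
  obtain ⟨J, γ, hJ, hJ', hx, ht, hγ, hγx, rfl⟩ := h
  exact S.time_curve hJ hJ' hγ hx (by rw [hγx]) t ht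

theorem rel_iff {x y : 𝓜} : S.Rel x y ↔ ∃ (l u : ℝ) (γ : ℝ → 𝓜), S.time x ∈ Ioo l u ∧
    S.time y ∈ Ioo l u ∧ IsMIntegralCurveOn γ S.dt (Ioo l u) ∧ γ (S.time x) = x ∧
    γ (S.time y) = y := by
  constructor
  · rintro ⟨t, h⟩
    have ht := h.time_eq
    obtain ⟨J, γ, hJ, hJ', hx, ht', hγ, hγx, hγy⟩ := h
    subst ht
    obtain ⟨l, u, h1, h2, h3⟩ := exists_Ioo_subset hJ hJ' hx ht'
    exact ⟨l, u, γ, h1, h2, hγ.mono h3, hγx, hγy⟩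
  · rintro ⟨l, u, γ, h1, h2, hγ, hγx, hγy⟩
    exact ⟨S.time y, Ioo l u, γ, isOpen_Ioo, ordConnected_Ioo, h1, h2, hγ, hγx, hγy⟩

variable {S} in
theorem Rel.symm {x y : 𝓜} (h : S.Rel x y) : S.Rel y x := by
  rw [rel_iff] at h ⊢
  obtain ⟨l, u, γ, h1, h2, hγ, hγx, hγy⟩ := h
  exact ⟨l, u, γ, h2, h1, hγ, hγy, hγx⟩

variable {S} in
theorem Rel.eq_of_time_eq {x y : 𝓜} (h : S.Rel x y) (ht : S.time x = S.time y) : x = y := by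
  obtain ⟨l, u, γ, -, -, -, hγx, hγy⟩ := S.rel_iff.1 h
  rw [← hγx, ht, hγy]

theorem contMDiff_dt : ContMDiff (𝓡 (n + 1)) (𝓡 (n + 1)).tangent ∞
    (fun p => (⟨p, S.dt p⟩ : TangentBundle (𝓡 (n + 1)) 𝓜)) :=
  contMDiffOn_univ.1 S.dt_smooth

variable {S} in
theorem Rel.trans [T2Space 𝓜] {x y z : 𝓜} (h : S.Rel x y) (h' : S.Rel y z) : S.Rel x z := by
  classical
  obtain ⟨l, u, γ, hx, hy, hγ, hγx, hγy⟩ := S.rel_iff.1 h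
  obtain ⟨l', u', γ', hy', hz', hγ', hγy', hγz'⟩ := S.rel_iff.1 h'
  have hv : ContMDiff (𝓡 (n + 1)) (𝓡 (n + 1)).tangent 1
      (fun p => (⟨p, S.dt p⟩ : TangentBundle (𝓡 (n + 1)) 𝓜)) := S.contMDiff_dt.of_le (by simp)
  have heq : γ (S.time y) = γ' (S.time y) := by rw [hγy, hγy']
  have hcurve := isMIntegralCurveOn_piecewise hv hγ hγ' ⟨hy, hy'⟩ heq
  have heqOn := eqOn_piecewise_of_isMIntegralCurveOn_Ioo hv hγ hγ' ⟨hy, hy'⟩ heq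
  refine ⟨S.time z, Ioo l u ∪ Ioo l' u', piecewise (Ioo l u) γ γ', isOpen_Ioo.union isOpen_Ioo,
    (isPreconnected_Ioo.union _ hy hy' isPreconnected_Ioo).ordConnected, Or.inl hx, Or.inr hz',
    hcurve, ?_, ?_⟩
  · rw [piecewise_eq_of_mem _ _ _ hx, hγx]
  · rw [heqOn hz', hγz']

/-! ### Worldlines in flow boxes -/

namespace IsFlowBox

variable {S} {F : OpenPartialHomeomorph 𝓜 (EuclideanSpace ℝ (Fin n) × ℝ)}

theorem time_symm (hF : S.IsFlowBox F) {q : EuclideanSpace ℝ (Fin n) × ℝ} (hq : q ∈ F.target) :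
    S.time (F.symm q) = q.2 := by
  rw [← hF.snd_eq _ (F.map_target hq), F.right_inv hq]

theorem mem_target_of_mem (hF : S.IsFlowBox F) {q q' : EuclideanSpace ℝ (Fin n) × ℝ}
    (hq : q ∈ F.target) (hq' : q' ∈ F.target) : (q.1, q'.2) ∈ F.target := by
  obtain ⟨c, r, h⟩ := hF.target_eq
  rw [h, ← ball_prod_same] at hq hq' ⊢
  exact ⟨hq.1, hq'.2⟩

theorem rel_symm (hF : S.IsFlowBox F) {b : EuclideanSpace ℝ (Fin n)} {t t' : ℝ}
    (h : (b, t) ∈ F.target) (h' : (b, t') ∈ F.target) : S.Rel (F.symm (b, t)) (F.symm (b, t')) := by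
  obtain ⟨c, r, hcr⟩ := hF.target_eq
  rw [← ball_prod_same] at hcr
  have hb : b ∈ Metric.ball c.1 r := by rw [hcr] at h; exact h.1
  refine ⟨t', Metric.ball c.2 r, fun s => F.symm (b, s), Metric.isOpen_ball,
    ?_, ?_, ?_, ?_, ?_, rfl⟩
  · rw [Real.ball_eq_Ioo]
    exact ordConnected_Ioo
  · rw [hF.time_symm h]
    rw [hcr] at h
    exact h.2
  · rw [hcr] at h'
    exact h'.2
  · intro s hs
    have hbs : (b, s) ∈ F.target := by
      rw [hcr]
      exact ⟨hb, hs⟩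
    exact (hF.hasMFDerivAt (b, s) hbs).hasMFDerivWithinAt
  · rw [hF.time_symm h]

/-- The time of the centre of a flow box. -/
def centerTime (hF : S.IsFlowBox F) : ℝ := hF.target_eq.choose.2

theorem prodMk_centerTime_mem (hF : S.IsFlowBox F) {b : EuclideanSpace ℝ (Fin n)}
    (hb : b ∈ Prod.fst '' F.target) : (b, hF.centerTime) ∈ F.target := by
  obtain ⟨⟨b', t⟩, hq, rfl⟩ := hb
  obtain ⟨r, hr⟩ := hF.target_eq.choose_spec
  rw [hr, ← ball_prod_same] at hq ⊢
  exact ⟨hq.1, Metric.mem_ball_self (Metric.pos_of_mem_ball hq.1)⟩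

theorem mdifferentiableAt (hF : S.IsFlowBox F) {z : 𝓜} (hz : z ∈ F.source) :
    MDifferentiableAt (𝓡 (n + 1)) 𝓘(ℝ, EuclideanSpace ℝ (Fin n) × ℝ) F z :=
  (hF.contMDiffOn.contMDiffAt (F.open_source.mem_nhds hz)).mdifferentiableAt (by simp)

theorem mvfderiv_dt (hF : S.IsFlowBox F) {z : 𝓜} (hz : z ∈ F.source) :
    mvfderiv (𝓡 (n + 1)) F z (S.dt z) = (0, 1) := by
  have hq := F.map_source hz
  have hzq : F.symm ((F z).1, (F z).2) = z := F.left_inv hz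
  have h1 := hF.hasMFDerivAt (F z) hq
  have h2 := hasDerivAt_comp_of_hasMFDerivAt (f := F) (γ := fun s => F.symm ((F z).1, s))
    (s := (F z).2) (by rw [hzq]; exact hF.mdifferentiableAt hz) h1
  have h3 : HasDerivAt (fun s : ℝ => ((F z).1, s)) ((0 : EuclideanSpace ℝ (Fin n)), (1 : ℝ))
      (F z).2 := (hasDerivAt_const _ _).prodMk (hasDerivAt_id _)
  have h4 : (F ∘ fun s => F.symm ((F z).1, s)) =ᶠ[𝓝 (F z).2] fun s => ((F z).1, s) := by
    have hc : ContinuousAt (fun s : ℝ => ((F z).1, s)) (F z).2 := by fun_prop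
    filter_upwards [hc.preimage_mem_nhds (F.open_target.mem_nhds hq)] with s hs
    exact F.right_inv hs
  have h5 := h2.unique (h3.congr_of_eventuallyEq h4)
  rw [← h5]
  change _ = mvfderiv (𝓡 (n + 1)) F (F.symm (F z)) (S.dt (F.symm (F z)))
  rw [F.left_inv hz]

end IsFlowBox

variable {S} in
theorem Rel.refl (x : 𝓜) : S.Rel x x := by
  obtain ⟨F, hx, hF⟩ := S.exists_isFlowBox x
  have h := hF.rel_symm (F.map_source hx) (F.map_source hx)
  change S.Rel (F.symm (F x)) (F.symm (F x)) at h
  rwa [F.left_inv hx] at h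

/-- A flow box around a point. -/
def box (x : 𝓜) : OpenPartialHomeomorph 𝓜 (EuclideanSpace ℝ (Fin n) × ℝ) :=
  (S.exists_isFlowBox x).choose

theorem mem_box_source (x : 𝓜) : x ∈ (S.box x).source := (S.exists_isFlowBox x).choose_spec.1

theorem isFlowBox_box (x : 𝓜) : S.IsFlowBox (S.box x) := (S.exists_isFlowBox x).choose_spec.2

theorem mem_worldlineDomain_of_le {x : 𝓜} {s t : ℝ} (ht : t ∈ S.worldlineDomain x)
    (hs : S.time x ≤ s) (hst : s ≤ t) : s ∈ S.worldlineDomain x := by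
  obtain ⟨y, J, γ, hJ, hJ', hx, ht', hγ, hγx, -⟩ := ht
  exact ⟨γ s, J, γ, hJ, hJ', hx, hJ'.out hx ht' ⟨hs, hst⟩, hγ, hγx, rfl⟩

/-! ### Holonomy along worldlines -/

/-- There is a smooth germ at `y`, mapping `y` to `x`, that moves points along their worldlines. -/
def Holonomy (x y : 𝓜) : Prop :=
  ∃ θ : 𝓜 → 𝓜, ContMDiffAt (𝓡 (n + 1)) (𝓡 (n + 1)) ∞ θ y ∧ θ y = x ∧ ∀ᶠ z in 𝓝 y, S.Rel z (θ z)

variable {S}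

theorem Holonomy.trans [T2Space 𝓜] {x y z : 𝓜} (h : S.Holonomy x y) (h' : S.Holonomy y z) :
    S.Holonomy x z := by
  obtain ⟨θ, hθ, rfl, hr⟩ := h
  obtain ⟨θ', hθ', rfl, hr'⟩ := h'
  refine ⟨θ ∘ θ', hθ.comp z hθ', rfl, ?_⟩
  filter_upwards [hr', hθ'.continuousAt.eventually hr] with w h1 h2
  exact h1.trans h2

theorem IsFlowBox.holonomy {F : OpenPartialHomeomorph 𝓜 (EuclideanSpace ℝ (Fin n) × ℝ)}
    (hF : S.IsFlowBox F) {b : EuclideanSpace ℝ (Fin n)} {t t' : ℝ} (h : (b, t) ∈ F.target)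
    (h' : (b, t') ∈ F.target) : S.Holonomy (F.symm (b, t)) (F.symm (b, t')) := by
  have hz := F.map_target h'
  have hFz : F (F.symm (b, t')) = (b, t') := F.right_inv h'
  refine ⟨fun z => F.symm ((F z).1, t), ?_, ?_, ?_⟩
  · have h1 : ContMDiffAt (𝓡 (n + 1)) 𝓘(ℝ, EuclideanSpace ℝ (Fin n) × ℝ) ∞
        (fun z => ((F z).1, t)) (F.symm (b, t')) :=
      ContMDiffAt.prodMk_space
        (contDiff_fst.contMDiff.contMDiffAt.comp _
          (hF.contMDiffOn.contMDiffAt (F.open_source.mem_nhds hz)))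
        contMDiffAt_const
    refine ContMDiffAt.comp _ (hF.contMDiffOn_symm.contMDiffAt (F.open_target.mem_nhds ?_)) h1
    rw [hFz]
    exact h
  · simp only [hFz]
  · filter_upwards [F.open_source.mem_nhds hz] with z hz'
    have h1 := hF.mem_target_of_mem (F.map_source hz') h
    have h2 := hF.rel_symm (F.map_source hz') h1
    change S.Rel (F.symm (F z)) _ at h2
    rwa [F.left_inv hz'] at h2

theorem Rel.holonomy [T2Space 𝓜] {x y : 𝓜} (h : S.Rel x y) : S.Holonomy x y := by
  obtain ⟨l, u, γ, hx, hy, hγ, hγx, hγy⟩ := S.rel_iff.1 h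
  rw [← hγx, ← hγy]
  refine isPreconnected_Ioo.induction₂' (fun s s' => S.Holonomy (γ s) (γ s')) ?_
    (fun _ _ _ _ _ _ h1 h2 => h1.trans h2) hx hy
  intro s hs
  obtain ⟨F, hsF, hF⟩ := S.exists_isFlowBox (γ s)
  have hcont : ContinuousAt γ s :=
    (hγ s hs).continuousWithinAt.continuousAt (isOpen_Ioo.mem_nhds hs)
  obtain ⟨ε, hε, hεs⟩ := Metric.mem_nhds_iff.1 (Filter.inter_mem (isOpen_Ioo.mem_nhds hs)
    (hcont.preimage_mem_nhds (F.open_source.mem_nhds hsF)))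
  refine mem_nhdsWithin_of_mem_nhds ?_
  filter_upwards [Metric.ball_mem_nhds s hε] with s' hs'
  have hder : ∀ r ∈ Metric.ball s ε, HasDerivAt (fun r => (F (γ r)).1) 0 r := by
    intro r hr
    have h1 := hasDerivAt_comp_of_hasMFDerivAt (hF.mdifferentiableAt (hεs hr).2)
      ((hγ r (hεs hr).1).hasMFDerivAt (isOpen_Ioo.mem_nhds (hεs hr).1))
    rw [hF.mvfderiv_dt (hεs hr).2] at h1
    exact h1.fst
  have hconst : (F (γ s')).1 = (F (γ s)).1 := Metric.isOpen_ball.is_const_of_deriv_eq_zero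
    (convex_ball s ε).isPreconnected
    (fun r hr => (hder r hr).differentiableAt.differentiableWithinAt)
    (fun r hr => (hder r hr).deriv) hs' (Metric.mem_ball_self hε)
  have hs'F : γ s' ∈ F.source := (hεs hs').2
  have h1 : ((F (γ s)).1, (F (γ s)).2) ∈ F.target := F.map_source hsF
  have h2 : ((F (γ s)).1, (F (γ s')).2) ∈ F.target := hconst ▸ F.map_source hs'F
  have e1 : F.symm ((F (γ s)).1, (F (γ s)).2) = γ s := F.left_inv hsF
  have e2 : F.symm ((F (γ s)).1, (F (γ s')).2) = γ s' := by
    rw [← hconst]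
    exact F.left_inv hs'F
  have h3 := hF.holonomy h1 h2
  have h4 := hF.holonomy h2 h1
  rw [e1, e2] at h3 h4
  exact ⟨h3, h4⟩

end PreSpacetime

end RicciSpacetime

end

noncomputable section

namespace RicciSpacetime

namespace PreSpacetime

variable {n : ℕ} {𝓜 : Type u} [TopologicalSpace 𝓜]
  [ChartedSpace (EuclideanSpace ℝ (Fin (n + 1))) 𝓜] [IsManifold (𝓡 (n + 1)) ∞ 𝓜] [T2Space 𝓜]
  {I : Set ℝ} (S : PreSpacetime n 𝓜 I)

/-! ### The space of worldlines -/

/-- Lying on a common worldline, as an equivalence relation. -/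
def worldlineSetoid : Setoid 𝓜 := ⟨S.Rel, Rel.refl, Rel.symm, Rel.trans⟩

/-- The space of worldlines, i.e. the direct limit of the time slices along the flow. -/
def WorldlineSpace : Type u := Quotient S.worldlineSetoid

/-- The worldline of a point. -/
def worldline (x : 𝓜) : S.WorldlineSpace := Quotient.mk S.worldlineSetoid x

theorem worldline_eq_iff {x y : 𝓜} : S.worldline x = S.worldline y ↔ S.Rel x y :=
  Quotient.eq (r := S.worldlineSetoid)

theorem worldline_surjective : Function.Surjective S.worldline := Quotient.mk_surjective

instance : TopologicalSpace S.WorldlineSpace := inferInstanceAs (TopologicalSpace (Quotient _))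

theorem isQuotientMap_worldline : Topology.IsQuotientMap S.worldline := isQuotientMap_quotient_mk'

theorem continuous_worldline : Continuous S.worldline := S.isQuotientMap_worldline.continuous

theorem isOpenMap_worldline : IsOpenMap S.worldline := by
  intro U hU
  rw [← S.isQuotientMap_worldline.isOpen_preimage, isOpen_iff_mem_nhds]
  rintro y ⟨x, hx, hxy⟩
  obtain ⟨θ, hθ, rfl, hr⟩ := (S.worldline_eq_iff.1 hxy).holonomy
  filter_upwards [hr, hθ.continuousAt.preimage_mem_nhds (hU.mem_nhds hx)] with z h1 h2
  exact ⟨θ z, h2, (S.worldline_eq_iff.2 h1).symm⟩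

theorem worldline_injOn_slice {x y : 𝓜} (h : S.worldline x = S.worldline y)
    (ht : S.time x = S.time y) : x = y :=
  (S.worldline_eq_iff.1 h).eq_of_time_eq ht

/-! ### Charts of the space of worldlines -/

namespace IsFlowBox

variable {S} {F : OpenPartialHomeomorph 𝓜 (EuclideanSpace ℝ (Fin n) × ℝ)} (hF : S.IsFlowBox F)

/-- The worldlines in a flow box, parametrized by their spatial coordinates. -/
def leaf (b : EuclideanSpace ℝ (Fin n)) : S.WorldlineSpace :=
  S.worldline (F.symm (b, hF.centerTime))

theorem leaf_eq {b : EuclideanSpace ℝ (Fin n)} {t : ℝ} (h : (b, t) ∈ F.target) :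
    hF.leaf b = S.worldline (F.symm (b, t)) :=
  S.worldline_eq_iff.2 (hF.rel_symm (hF.prodMk_centerTime_mem ⟨_, h, rfl⟩) h)

theorem leaf_fst {z : 𝓜} (hz : z ∈ F.source) : hF.leaf (F z).1 = S.worldline z :=
  (hF.leaf_eq (b := (F z).1) (t := (F z).2) (F.map_source hz)).trans
    (congrArg S.worldline (F.left_inv hz))

theorem leaf_injOn : InjOn hF.leaf (Prod.fst '' F.target) := by
  intro b hb b' hb' h
  have h1 := hF.prodMk_centerTime_mem hb
  have h2 := hF.prodMk_centerTime_mem hb'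
  have h3 := S.worldline_injOn_slice h (by rw [hF.time_symm h1, hF.time_symm h2])
  exact congrArg Prod.fst (F.symm.injOn h1 h2 h3)

theorem leaf_continuousOn : ContinuousOn hF.leaf (Prod.fst '' F.target) :=
  S.continuous_worldline.comp_continuousOn
    (F.continuousOn_symm.comp (by fun_prop) fun _ hb => hF.prodMk_centerTime_mem hb)

theorem leaf_isOpenMap : IsOpenMap ((Prod.fst '' F.target).domRestrict hF.leaf) := by
  intro V hV
  obtain ⟨U, hU, rfl⟩ := isOpen_induced_iff.1 hV
  have h1 : (Prod.fst '' F.target).domRestrict hF.leaf '' (Subtype.val ⁻¹' U)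
      = S.worldline '' (F.symm '' (F.target ∩ Prod.fst ⁻¹' U)) := by
    ext p
    constructor
    · rintro ⟨⟨b, hb⟩, hbU, rfl⟩
      exact ⟨_, ⟨_, ⟨hF.prodMk_centerTime_mem hb, hbU⟩, rfl⟩, rfl⟩
    · rintro ⟨_, ⟨⟨b, t⟩, ⟨hq, hqU⟩, rfl⟩, rfl⟩
      exact ⟨⟨b, ⟨_, hq, rfl⟩⟩, hqU, hF.leaf_eq hq⟩
  rw [h1]
  exact S.isOpenMap_worldline _ (F.isOpen_image_symm_of_subset_target
    (F.open_target.inter (hU.preimage continuous_fst)) inter_subset_left)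

/-- The chart of the space of worldlines given by a flow box. -/
def leafChart : OpenPartialHomeomorph S.WorldlineSpace (EuclideanSpace ℝ (Fin n)) :=
  (OpenPartialHomeomorph.ofContinuousOpenRestrict (hF.leaf_injOn.toPartialEquiv _ _)
    hF.leaf_continuousOn hF.leaf_isOpenMap (isOpenMap_fst _ F.open_target)).symm

theorem fst_mem_leafChart_target {z : 𝓜} (hz : z ∈ F.source) : (F z).1 ∈ hF.leafChart.target :=
  ⟨_, F.map_source hz, rfl⟩

theorem worldline_mem_leafChart_source {z : 𝓜} (hz : z ∈ F.source) :
    S.worldline z ∈ hF.leafChart.source := by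
  rw [← hF.leaf_fst hz]
  exact hF.leafChart.map_target (hF.fst_mem_leafChart_target hz)

theorem leafChart_worldline {z : 𝓜} (hz : z ∈ F.source) :
    hF.leafChart (S.worldline z) = (F z).1 := by
  rw [← hF.leaf_fst hz]
  exact hF.leafChart.right_inv (hF.fst_mem_leafChart_target hz)

theorem contMDiffAt_leafChart_worldline {y : 𝓜} (hy : S.worldline y ∈ hF.leafChart.source) :
    ContMDiffAt (𝓡 (n + 1)) (𝓡 n) ∞ (fun z => hF.leafChart (S.worldline z)) y := by
  have hb := hF.prodMk_centerTime_mem (hF.leafChart.map_source hy)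
  have hxy : S.worldline (F.symm (hF.leafChart (S.worldline y), hF.centerTime)) = S.worldline y :=
    hF.leafChart.left_inv hy
  obtain ⟨θ, hθ, hθy, hr⟩ := (S.worldline_eq_iff.1 hxy).holonomy
  have hθF : θ y ∈ F.source := hθy ▸ F.map_target hb
  have h1 : ContMDiffAt (𝓡 (n + 1)) (𝓡 n) ∞ (fun z => (F z).1) (θ y) :=
    contDiff_fst.contMDiff.contMDiffAt.comp _
      (hF.contMDiffOn.contMDiffAt (F.open_source.mem_nhds hθF))
  refine (h1.comp y hθ).congr_of_eventuallyEq ?_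
  filter_upwards [hr, hθ.continuousAt.preimage_mem_nhds (F.open_source.mem_nhds hθF)] with z h2 h3
  rw [S.worldline_eq_iff.2 h2, hF.leafChart_worldline h3]
  rfl

end IsFlowBox

instance : ChartedSpace (EuclideanSpace ℝ (Fin n)) S.WorldlineSpace where
  atlas := range fun x => (S.isFlowBox_box x).leafChart
  chartAt p := (S.isFlowBox_box (Quotient.out p)).leafChart
  mem_chart_source p := by
    have h := (S.isFlowBox_box (Quotient.out p)).worldline_mem_leafChart_source (S.mem_box_source _)
    rwa [show S.worldline (Quotient.out p) = p from Quotient.out_eq p] at h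
  chart_mem_atlas p := mem_range_self _

instance : IsManifold (𝓡 n) ∞ S.WorldlineSpace := by
  refine isManifold_of_contDiffOn _ _ _ ?_
  rintro _ _ ⟨x, rfl⟩ ⟨x', rfl⟩
  set hF := S.isFlowBox_box x
  set hF' := S.isFlowBox_box x'
  rintro b ⟨hb, -⟩
  have hb1 : b ∈ Prod.fst '' (S.box x).target := hb.1
  have hb2 : S.worldline ((S.box x).symm (b, hF.centerTime)) ∈ hF'.leafChart.source := hb.2
  have hq := hF.prodMk_centerTime_mem hb1
  have h1 : ContMDiffAt (𝓡 n) 𝓘(ℝ, EuclideanSpace ℝ (Fin n) × ℝ) ∞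
      (fun b => (b, hF.centerTime)) b :=
    contMDiffAt_id.prodMk_space contMDiffAt_const
  have h2 := hF.contMDiffOn_symm.contMDiffAt ((S.box x).open_target.mem_nhds hq)
  have h3 : ContMDiffAt (𝓡 n) (𝓡 n) ∞
      (fun b => hF'.leafChart (S.worldline ((S.box x).symm (b, hF.centerTime)))) b :=
    ContMDiffAt.comp (f := fun b => (S.box x).symm (b, hF.centerTime))
      (g := fun z => hF'.leafChart (S.worldline z)) b (hF'.contMDiffAt_leafChart_worldline hb2)
      (ContMDiffAt.comp (f := fun b => (b, hF.centerTime)) b h2 h1)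
  exact h3.contDiffAt.contDiffWithinAt

theorem contMDiff_worldline : ContMDiff (𝓡 (n + 1)) (𝓡 n) ∞ S.worldline := by
  intro x
  refine contMDiffAt_iff_target.2 ⟨S.continuous_worldline.continuousAt, ?_⟩
  exact (S.isFlowBox_box _).contMDiffAt_leafChart_worldline (mem_chart_source _ (S.worldline x))

theorem contMDiffOn_leafChart (x : 𝓜) :
    ContMDiffOn (𝓡 n) (𝓡 n) ∞ (S.isFlowBox_box x).leafChart (S.isFlowBox_box x).leafChart.source :=
  contMDiffOn_of_mem_maximalAtlas (IsManifold.subset_maximalAtlas (mem_range_self x))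

theorem secondCountableTopology_worldlineSpace [SecondCountableTopology 𝓜] :
    SecondCountableTopology S.WorldlineSpace :=
  S.isQuotientMap_worldline.secondCountableTopology S.isOpenMap_worldline

theorem connectedSpace_worldlineSpace [ConnectedSpace 𝓜] : ConnectedSpace S.WorldlineSpace :=
  S.worldline_surjective.connectedSpace S.continuous_worldline

/-! ### The embedding into the product with the time axis -/

/-- The map `x ↦ (worldline of x, 𝔱 x)`. -/
def toProd (x : 𝓜) : S.WorldlineSpace × ℝ := (S.worldline x, S.time x)

theorem toProd_injective : Function.Injective S.toProd := fun _ _ h =>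
  S.worldline_injOn_slice (congrArg Prod.fst h) (congrArg Prod.snd h)

theorem contMDiff_toProd : ContMDiff (𝓡 (n + 1)) ((𝓡 n).prod 𝓘(ℝ, ℝ)) ∞ S.toProd :=
  S.contMDiff_worldline.prodMk S.time_smooth

/-- A left inverse of `toProd`. -/
def ofProd [Nonempty 𝓜] : S.WorldlineSpace × ℝ → 𝓜 := Function.invFun S.toProd

theorem ofProd_toProd [Nonempty 𝓜] (x : 𝓜) : S.ofProd (S.toProd x) = x :=
  Function.leftInverse_invFun S.toProd_injective x

theorem toProd_ofProd [Nonempty 𝓜] {q : S.WorldlineSpace × ℝ} (hq : q ∈ range S.toProd) :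
    S.toProd (S.ofProd q) = q := by
  obtain ⟨x, rfl⟩ := hq
  rw [ofProd_toProd]

theorem eventually_toProd_symm (x : 𝓜) : ∀ᶠ q in 𝓝 (S.toProd x),
    S.toProd ((S.box x).symm ((S.isFlowBox_box x).leafChart q.1, q.2)) = q := by
  set hF := S.isFlowBox_box x
  have hx := S.mem_box_source x
  have hs : hF.leafChart.source ∈ 𝓝 (S.worldline x) :=
    hF.leafChart.open_source.mem_nhds (hF.worldline_mem_leafChart_source hx)
  have h1 : ContinuousAt (fun q : S.WorldlineSpace × ℝ => (hF.leafChart q.1, q.2)) (S.toProd x) :=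
    ((hF.leafChart.continuousAt (hF.worldline_mem_leafChart_source hx)).comp (x := S.toProd x)
      (f := Prod.fst) continuousAt_fst).prodMk continuousAt_snd
  have h2 : (hF.leafChart (S.worldline x), S.time x) ∈ (S.box x).target := by
    rw [hF.leafChart_worldline hx, ← hF.snd_eq x hx]
    exact (S.box x).map_source hx
  filter_upwards [h1.preimage_mem_nhds ((S.box x).open_target.mem_nhds h2),
    continuousAt_fst.preimage_mem_nhds hs] with q h3 h4
  refine Prod.ext ?_ (hF.time_symm h3)
  exact (hF.leaf_eq h3).symm.trans (hF.leafChart.left_inv h4)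

theorem isOpen_range_toProd : IsOpen (range S.toProd) := by
  rw [isOpen_iff_mem_nhds]
  rintro _ ⟨x, rfl⟩
  filter_upwards [S.eventually_toProd_symm x] with q hq
  exact ⟨_, hq⟩

theorem contMDiffAt_ofProd [Nonempty 𝓜] {q : S.WorldlineSpace × ℝ} (hq : q ∈ range S.toProd) :
    ContMDiffAt ((𝓡 n).prod 𝓘(ℝ, ℝ)) (𝓡 (n + 1)) ∞ S.ofProd q := by
  obtain ⟨x, rfl⟩ := hq
  set hF := S.isFlowBox_box x
  have hx := S.mem_box_source x
  have hs : hF.leafChart.source ∈ 𝓝 (S.worldline x) :=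
    hF.leafChart.open_source.mem_nhds (hF.worldline_mem_leafChart_source hx)
  have h1 : ContMDiffAt ((𝓡 n).prod 𝓘(ℝ, ℝ)) 𝓘(ℝ, EuclideanSpace ℝ (Fin n) × ℝ) ∞
      (fun q : S.WorldlineSpace × ℝ => (hF.leafChart q.1, q.2)) (S.toProd x) :=
    (ContMDiffAt.comp (f := Prod.fst) (S.toProd x) ((S.contMDiffOn_leafChart x).contMDiffAt hs)
      contMDiffAt_fst).prodMk_space contMDiffAt_snd
  have h2 : (hF.leafChart (S.worldline x), S.time x) ∈ (S.box x).target := by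
    rw [hF.leafChart_worldline hx, ← hF.snd_eq x hx]
    exact (S.box x).map_source hx
  refine ((hF.contMDiffOn_symm.contMDiffAt ((S.box x).open_target.mem_nhds h2)).comp
    (S.toProd x) h1).congr_of_eventuallyEq ?_
  filter_upwards [S.eventually_toProd_symm x] with q hq
  conv_lhs => rw [← hq]
  rw [ofProd_toProd]
  rfl

theorem contMDiffOn_ofProd [Nonempty 𝓜] :
    ContMDiffOn ((𝓡 n).prod 𝓘(ℝ, ℝ)) (𝓡 (n + 1)) ∞ S.ofProd (range S.toProd) :=
  fun _ hq => (S.contMDiffAt_ofProd hq).contMDiffWithinAt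

theorem isOpen_image_worldline_slice {U : Set 𝓜} (hU : IsOpen U) (t : ℝ) :
    IsOpen (S.worldline '' (U ∩ S.slice t)) := by
  rcases isEmpty_or_nonempty 𝓜 with _ | _
  · rw [Subsingleton.elim (U ∩ S.slice t) ∅, image_empty]
    exact isOpen_empty
  have h1 : IsOpen (S.toProd '' U) := by
    have : S.toProd '' U = range S.toProd ∩ S.ofProd ⁻¹' U := by
      ext q
      constructor
      · rintro ⟨x, hx, rfl⟩
        exact ⟨mem_range_self x, by rwa [mem_preimage, ofProd_toProd]⟩
      · rintro ⟨⟨x, rfl⟩, hx⟩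
        rw [mem_preimage, ofProd_toProd] at hx
        exact ⟨x, hx, rfl⟩
    rw [this]
    exact S.contMDiffOn_ofProd.continuousOn.isOpen_inter_preimage S.isOpen_range_toProd hU
  have h2 : S.worldline '' (U ∩ S.slice t) = (fun p => (p, t)) ⁻¹' (S.toProd '' U) := by
    ext p
    constructor
    · rintro ⟨x, ⟨hx, hxt⟩, rfl⟩
      exact ⟨x, hx, Prod.ext rfl hxt⟩
    · rintro ⟨x, hx, h⟩
      exact ⟨x, ⟨hx, congrArg Prod.snd h⟩, congrArg Prod.fst h⟩
  rw [h2]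
  exact h1.preimage (by fun_prop)

theorem isDiffeo_toProd [Nonempty 𝓜] :
    IsDiffeoOntoOpenImageOn (𝓡 (n + 1)) ((𝓡 n).prod 𝓘(ℝ, ℝ)) univ S.toProd := by
  refine ⟨S.contMDiff_toProd.contMDiffOn, ?_, S.ofProd, ?_, fun x _ => S.ofProd_toProd x⟩
  · rw [image_univ]
    exact S.isOpen_range_toProd
  · rw [image_univ]
    exact S.contMDiffOn_ofProd

theorem isDiffeo_worldline_slice [Nonempty 𝓜] (t : ℝ) :
    IsDiffeoOntoOpenImageOn (𝓡 (n + 1)) (𝓡 n) (S.slice t) S.worldline := by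
  refine ⟨S.contMDiff_worldline.contMDiffOn, ?_, fun p => S.ofProd (p, t), ?_, ?_⟩
  · simpa using S.isOpen_image_worldline_slice isOpen_univ t
  · refine S.contMDiffOn_ofProd.comp (contMDiff_id.prodMk contMDiff_const).contMDiffOn ?_
    rintro _ ⟨x, hx, rfl⟩
    exact ⟨x, Prod.ext rfl hx⟩
  · intro x hx
    have : (S.worldline x, t) = S.toProd x := Prod.ext rfl hx.symm
    exact (congrArg S.ofProd this).trans (S.ofProd_toProd x)

end PreSpacetime

/-! ### The Hausdorff property -/

theorem IsExpanding.t2Space {n : ℕ} {𝓜 : Type u} [TopologicalSpace 𝓜]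
    [ChartedSpace (EuclideanSpace ℝ (Fin (n + 1))) 𝓜] [IsManifold (𝓡 (n + 1)) ∞ 𝓜] [T2Space 𝓜]
    {T : EReal} {S : RicciFlowSpacetime n 𝓜 (timeInterval T)} (hS : IsExpanding S) :
    T2Space S.WorldlineSpace := by
  have key : ∀ (x : 𝓜) (s : ℝ), S.time x ≤ s → (s : EReal) < T →
      ∃ x', S.time x' = s ∧ S.worldline x' = S.worldline x := by
    intro x s hs hsT
    rw [← hS x, PreSpacetime.vanishingTime, lt_sSup_iff] at hsT
    obtain ⟨_, ⟨t, ht, rfl⟩, hst⟩ := hsT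
    obtain ⟨x', hx'⟩ := S.mem_worldlineDomain_of_le ht hs (EReal.coe_lt_coe_iff.1 hst).le
    exact ⟨x', hx'.time_eq, (S.worldline_eq_iff.2 ⟨s, hx'⟩).symm⟩
  refine ⟨fun p q hpq => ?_⟩
  obtain ⟨x, rfl⟩ := S.worldline_surjective p
  obtain ⟨y, rfl⟩ := S.worldline_surjective q
  have hs : ((max (S.time x) (S.time y) : ℝ) : EReal) < T := by
    rcases max_choice (S.time x) (S.time y) with h | h <;> rw [h]
    exacts [(S.time_mem x).2, (S.time_mem y).2]
  obtain ⟨x', hx't, hx'⟩ := key x _ (le_max_left _ _) hs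
  obtain ⟨y', hy't, hy'⟩ := key y _ (le_max_right _ _) hs
  rw [← hx', ← hy'] at hpq ⊢
  obtain ⟨U, V, hU, hV, hxU, hyV, hUV⟩ := t2_separation (fun h => hpq (congrArg _ h))
  refine ⟨_, _, S.isOpen_image_worldline_slice hU _, S.isOpen_image_worldline_slice hV _,
    ⟨x', ⟨hxU, hx't⟩, rfl⟩, ⟨y', ⟨hyV, hy't⟩, rfl⟩, ?_⟩
  rw [Set.disjoint_left]
  rintro _ ⟨z, ⟨hzU, hz⟩, rfl⟩ ⟨w, ⟨hwV, hw⟩, h⟩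
  have : w = z := S.worldline_injOn_slice h (hw.trans hz.symm)
  exact Set.disjoint_left.1 hUV hzU (this ▸ hwV)

end RicciSpacetime

end

noncomputable section

namespace RicciSpacetime

/-! ### The Ricci tensor depends only on the germ of the metric -/

theorem pderiv_congr {n : ℕ} {k : Fin n} {f f' : EuclideanSpace ℝ (Fin n) → ℝ}
    {y : EuclideanSpace ℝ (Fin n)} (h : f =ᶠ[𝓝 y] f') : pderiv k f y = pderiv k f' y := by
  rw [pderiv, pderiv, h.fderiv_eq]

theorem christoffel_congr {n : ℕ}
    {G G' : EuclideanSpace ℝ (Fin n) → Matrix (Fin n) (Fin n) ℝ} {y : EuclideanSpace ℝ (Fin n)}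
    (h : G =ᶠ[𝓝 y] G') (k i j : Fin n) : christoffel G k i j y = christoffel G' k i j y := by
  have h1 : ∀ a b, (fun z => G z a b) =ᶠ[𝓝 y] fun z => G' z a b := fun a b =>
    h.mono fun z hz => by simp only [hz]
  simp only [christoffel, h.eq_of_nhds, pderiv_congr (h1 _ _)]

theorem ricciCoord_congr {n : ℕ}
    {G G' : EuclideanSpace ℝ (Fin n) → Matrix (Fin n) (Fin n) ℝ} {y : EuclideanSpace ℝ (Fin n)}
    (h : G =ᶠ[𝓝 y] G') (a b : EuclideanSpace ℝ (Fin n)) :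
    ricciCoord G y a b = ricciCoord G' y a b := by
  have h1 : ∀ k i j, christoffel G k i j =ᶠ[𝓝 y] christoffel G' k i j := fun k i j =>
    (eventually_eventually_nhds.2 h).mono fun z hz => christoffel_congr hz k i j
  simp only [ricciCoord, ricciCoeff, pderiv_congr (h1 _ _ _), (h1 _ _ _).eq_of_nhds]

theorem isInvertible_of_injective {n : ℕ}
    {A : EuclideanSpace ℝ (Fin (n + 1)) →L[ℝ] EuclideanSpace ℝ (Fin n) × ℝ}
    (hA : Function.Injective A) : A.IsInvertible := by
  refine ⟨(LinearEquiv.ofInjectiveOfFinrankEq (A : _ →ₗ[ℝ] _) hA ?_).toContinuousLinearEquiv, ?_⟩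
  · simp
  · ext v : 1
    rfl

namespace PreSpacetime

variable {n : ℕ} {𝓜 : Type u} [TopologicalSpace 𝓜]
  [ChartedSpace (EuclideanSpace ℝ (Fin (n + 1))) 𝓜] [IsManifold (𝓡 (n + 1)) ∞ 𝓜]
  {I : Set ℝ} (S : PreSpacetime n 𝓜 I)

/-- The projection onto spatial vectors as a linear map. -/
def projₗ (x : 𝓜) : TangentSpace (𝓡 (n + 1)) x →ₗ[ℝ] spat n S.time x where
  toFun := S.proj x
  map_add' v w := Subtype.ext <| by
    change v + w - mvfderiv (𝓡 (n + 1)) S.time x (v + w) • S.dt x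
      = v - mvfderiv (𝓡 (n + 1)) S.time x v • S.dt x
        + (w - mvfderiv (𝓡 (n + 1)) S.time x w • S.dt x)
    rw [map_add, add_smul]
    abel
  map_smul' c v := Subtype.ext <| by
    change c • v - mvfderiv (𝓡 (n + 1)) S.time x (c • v) • S.dt x
      = c • (v - mvfderiv (𝓡 (n + 1)) S.time x v • S.dt x)
    rw [map_smul, smul_sub, smul_assoc]

theorem proj_coe {x : 𝓜} (v : spat n S.time x) : S.proj x v = v := Subtype.ext <| by
  change v.1 - mvfderiv (𝓡 (n + 1)) S.time x v.1 • S.dt x = v.1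
  rw [show mvfderiv (𝓡 (n + 1)) S.time x v.1 = 0 from v.2, zero_smul, sub_zero]

theorem proj_of_mem {x : 𝓜} {v : TangentSpace (𝓡 (n + 1)) x}
    (hv : mvfderiv (𝓡 (n + 1)) S.time x v = 0) : (S.proj x v).1 = v :=
  congrArg Subtype.val (S.proj_coe ⟨v, hv⟩)

theorem met_zero_left (x : 𝓜) (w : TangentSpace (𝓡 (n + 1)) x) : S.met x 0 w = 0 := by
  change S.g x (S.projₗ x 0) _ = 0
  rw [map_zero, map_zero, LinearMap.zero_apply]

theorem met_zero_right (x : 𝓜) (v : TangentSpace (𝓡 (n + 1)) x) : S.met x v 0 = 0 := by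
  change S.g x _ (S.projₗ x 0) = 0
  rw [map_zero, map_zero]

variable [T2Space 𝓜]

/-! ### Lifting vectors from the space of worldlines to the time slices -/

theorem mdifferentiableAt_worldline (x : 𝓜) :
    MDifferentiableAt (𝓡 (n + 1)) (𝓡 n) S.worldline x :=
  S.contMDiff_worldline.mdifferentiableAt (by simp)

theorem mfderiv_toProd (x : 𝓜) (v : TangentSpace (𝓡 (n + 1)) x) :
    mfderiv (𝓡 (n + 1)) ((𝓡 n).prod 𝓘(ℝ, ℝ)) S.toProd x v
      = (mfderiv (𝓡 (n + 1)) (𝓡 n) S.worldline x v, mvfderiv (𝓡 (n + 1)) S.time x v) := by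
  have := mfderiv_prodMk (S.mdifferentiableAt_worldline x)
    (S.time_smooth.mdifferentiableAt (by simp) (x := x))
  exact DFunLike.congr_fun this v

theorem mfderiv_toProd_injective (x : 𝓜) :
    Function.Injective (mfderiv (𝓡 (n + 1)) ((𝓡 n).prod 𝓘(ℝ, ℝ)) S.toProd x) := by
  have : Nonempty 𝓜 := ⟨x⟩
  have h1 := mfderiv_comp x
    ((S.contMDiffAt_ofProd (mem_range_self x)).mdifferentiableAt (by simp))
    (S.contMDiff_toProd.mdifferentiableAt (by simp))
  have h2 : S.ofProd ∘ S.toProd = id := funext S.ofProd_toProd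
  rw [h2, mfderiv_id] at h1
  refine Function.LeftInverse.injective
    (g := mfderiv ((𝓡 n).prod 𝓘(ℝ, ℝ)) (𝓡 (n + 1)) S.ofProd (S.toProd x)) fun v => ?_
  exact (DFunLike.congr_fun h1 v).symm

theorem isInvertible_mfderiv_toProd (x : 𝓜) :
    (mfderiv (𝓡 (n + 1)) ((𝓡 n).prod 𝓘(ℝ, ℝ)) S.toProd x).IsInvertible :=
  isInvertible_of_injective (S.mfderiv_toProd_injective x)

/-- The spatial lift to `x` of a tangent vector of the space of worldlines. -/
def lift (x : 𝓜) : EuclideanSpace ℝ (Fin n) →ₗ[ℝ] TangentSpace (𝓡 (n + 1)) x :=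
  LinearMap.comp
    (ContinuousLinearMap.toLinearMap
      (mfderiv (𝓡 (n + 1)) ((𝓡 n).prod 𝓘(ℝ, ℝ)) S.toProd x).inverse)
    (LinearMap.inl ℝ (EuclideanSpace ℝ (Fin n)) ℝ)

theorem mfderiv_toProd_lift (x : 𝓜) (v : EuclideanSpace ℝ (Fin n)) :
    mfderiv (𝓡 (n + 1)) ((𝓡 n).prod 𝓘(ℝ, ℝ)) S.toProd x (S.lift x v) = (v, (0 : ℝ)) :=
  (S.isInvertible_mfderiv_toProd x).self_apply_inverse _

theorem mfderiv_worldline_lift (x : 𝓜) (v : EuclideanSpace ℝ (Fin n)) :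
    mfderiv (𝓡 (n + 1)) (𝓡 n) S.worldline x (S.lift x v) = v :=
  congrArg Prod.fst ((S.mfderiv_toProd x _).symm.trans (S.mfderiv_toProd_lift x v))

theorem mvfderiv_time_lift (x : 𝓜) (v : EuclideanSpace ℝ (Fin n)) :
    mvfderiv (𝓡 (n + 1)) S.time x (S.lift x v) = 0 :=
  congrArg Prod.snd ((S.mfderiv_toProd x _).symm.trans (S.mfderiv_toProd_lift x v))

theorem eq_lift {x : 𝓜} {u : TangentSpace (𝓡 (n + 1)) x} {v : EuclideanSpace ℝ (Fin n)}
    (h1 : mfderiv (𝓡 (n + 1)) (𝓡 n) S.worldline x u = v)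
    (h2 : mvfderiv (𝓡 (n + 1)) S.time x u = 0) : u = S.lift x v := by
  apply S.mfderiv_toProd_injective x
  rw [S.mfderiv_toProd_lift, S.mfderiv_toProd, h1, h2]
  rfl

theorem proj_lift (x : 𝓜) (v : EuclideanSpace ℝ (Fin n)) :
    (S.proj x (S.lift x v)).1 = S.lift x v := S.proj_of_mem (S.mvfderiv_time_lift x v)

theorem mfderiv_worldline_dt (x : 𝓜) :
    mfderiv (𝓡 (n + 1)) (𝓡 n) S.worldline x (S.dt x) = 0 := by
  have hF := S.isFlowBox_box x
  have hx := S.mem_box_source x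
  have h1 := hF.hasMFDerivAt _ ((S.box x).map_source hx)
  have hxe : (S.box x).symm (S.box x x) = x := (S.box x).left_inv hx
  have h2 := HasMFDerivAt.comp (f := fun s => (S.box x).symm ((S.box x x).1, s)) (S.box x x).2
    (S.mdifferentiableAt_worldline _).hasMFDerivAt h1
  have h3 : (S.worldline ∘ fun s => (S.box x).symm ((S.box x x).1, s)) =ᶠ[𝓝 (S.box x x).2]
      fun _ => S.worldline x := by
    have hc : ContinuousAt (fun s : ℝ => ((S.box x x).1, s)) (S.box x x).2 := by fun_prop
    filter_upwards [hc.preimage_mem_nhds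
      ((S.box x).open_target.mem_nhds ((S.box x).map_source hx))] with s hs
    exact (hF.leaf_eq hs).symm.trans (hF.leaf_fst hx)
  have h4 := (hasMFDerivAt_const (I := 𝓘(ℝ, ℝ)) (I' := 𝓡 n) (S.worldline x)
    (S.box x x).2).congr_of_eventuallyEq h3
  have h5 := DFunLike.congr_fun (hasMFDerivAt_unique h2 h4) (1 : ℝ)
  have h6 : mfderiv (𝓡 (n + 1)) (𝓡 n) S.worldline ((S.box x).symm (S.box x x))
      ((1 : ℝ) • S.dt ((S.box x).symm (S.box x x))) = 0 := h5
  rw [one_smul, hxe] at h6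
  exact h6

theorem mfderiv_toProd_dt (x : 𝓜) :
    mfderiv (𝓡 (n + 1)) ((𝓡 n).prod 𝓘(ℝ, ℝ)) S.toProd x (S.dt x)
      = ((0 : EuclideanSpace ℝ (Fin n)), (1 : ℝ)) := by
  rw [S.mfderiv_toProd, S.mfderiv_worldline_dt, S.dt_time]
  rfl

/-- The spatial lift of a smooth vector field is smooth. -/
theorem smoothFieldOn_lift {W : Set S.WorldlineSpace} (hW : IsOpen W)
    {X : ∀ p : S.WorldlineSpace, TangentSpace (𝓡 n) p} (hX : SmoothFieldOn X W) :
    SmoothFieldOn (fun x => S.lift x (X (S.worldline x))) (S.worldline ⁻¹' W) := by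
  intro x hx
  let V : ∀ q : S.WorldlineSpace × ℝ, TangentSpace ((𝓡 n).prod 𝓘(ℝ, ℝ)) q :=
    fun q => (X q.1, (0 : ℝ))
  have h1 : ContMDiffAt ((𝓡 n).prod 𝓘(ℝ, ℝ)) (𝓡 n).tangent ∞
      (fun q : S.WorldlineSpace × ℝ => (⟨q.1, X q.1⟩ : TangentBundle (𝓡 n) S.WorldlineSpace))
      (S.toProd x) :=
    ContMDiffAt.comp (f := Prod.fst) (S.toProd x) (hX.contMDiffAt (hW.mem_nhds hx)) contMDiffAt_fst
  have h0 : ContMDiff 𝓘(ℝ, ℝ) 𝓘(ℝ, ℝ).tangent ∞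
      (fun t : ℝ => (⟨t, (0 : ℝ)⟩ : TangentBundle 𝓘(ℝ, ℝ) ℝ)) := fun t =>
    contMDiffAt_vectorSpace_iff_contDiffAt.2 contDiffAt_const
  have h2 : ContMDiffAt ((𝓡 n).prod 𝓘(ℝ, ℝ)) 𝓘(ℝ, ℝ).tangent ∞
      (fun q : S.WorldlineSpace × ℝ => (⟨q.2, (0 : ℝ)⟩ : TangentBundle 𝓘(ℝ, ℝ) ℝ))
      (S.toProd x) :=
    ContMDiffAt.comp (f := Prod.snd) (S.toProd x) h0.contMDiffAt contMDiffAt_snd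
  have h3 : ContMDiffAt ((𝓡 n).prod 𝓘(ℝ, ℝ)) ((𝓡 n).prod 𝓘(ℝ, ℝ)).tangent ∞
      (fun q => (⟨q, V q⟩ : TangentBundle ((𝓡 n).prod 𝓘(ℝ, ℝ)) (S.WorldlineSpace × ℝ)))
      (S.toProd x) :=
    ContMDiffAt.comp (S.toProd x) (contMDiff_equivTangentBundleProd_symm (I := 𝓡 n)
      (M := S.WorldlineSpace) (I' := 𝓘(ℝ, ℝ)) (M' := ℝ) (n := ∞)).contMDiffAt (h1.prodMk h2)
  exact (ContMDiffAt.mpullback_vectorField_preimage h3 S.contMDiff_toProd.contMDiffAt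
    (S.isInvertible_mfderiv_toProd x) (by simp)).contMDiffWithinAt

theorem smoothFieldOn_proj_lift {W : Set S.WorldlineSpace} (hW : IsOpen W)
    {X : ∀ p : S.WorldlineSpace, TangentSpace (𝓡 n) p} (hX : SmoothFieldOn X W) :
    SmoothFieldOn (fun x => (S.proj x (S.lift x (X (S.worldline x)))).1) (S.worldline ⁻¹' W) := by
  refine ContMDiffOn.congr (S.smoothFieldOn_lift hW hX) fun x _ => ?_
  exact congrArg (Bundle.TotalSpace.mk x) (S.proj_lift x _)

/-! ### The metrics on the space of worldlines -/

variable [Nonempty 𝓜]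

/-- The metric induced by `g(t)` at the worldline `p`. -/
def pushMetric (t : ℝ) (p : S.WorldlineSpace) : LinearMap.BilinForm ℝ (TangentSpace (𝓡 n) p) :=
  LinearMap.compl₁₂ (S.g (S.ofProd (p, t)))
    ((S.projₗ (S.ofProd (p, t))).comp (S.lift (S.ofProd (p, t))))
    ((S.projₗ (S.ofProd (p, t))).comp (S.lift (S.ofProd (p, t))))

theorem pushMetric_apply {t : ℝ} {p : S.WorldlineSpace} {x : 𝓜} (hx : S.toProd x = (p, t))
    (v w : EuclideanSpace ℝ (Fin n)) :
    S.pushMetric t p v w = S.met x (S.lift x v) (S.lift x w) := by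
  have h : S.ofProd (p, t) = x := by rw [← hx, ofProd_toProd]
  subst h
  rfl

theorem pushMetric_mfderiv (x : 𝓜) (v w : spat n S.time x) :
    S.pushMetric (S.time x) (S.worldline x) (mfderiv (𝓡 (n + 1)) (𝓡 n) S.worldline x v.1)
      (mfderiv (𝓡 (n + 1)) (𝓡 n) S.worldline x w.1) = S.g x v w := by
  refine (S.pushMetric_apply (x := x) rfl _ _).trans ?_
  rw [← S.eq_lift rfl v.2, ← S.eq_lift rfl w.2, met, proj_coe, proj_coe]

theorem contMDiffOn_pushMetric {W : Set S.WorldlineSpace} (hW : IsOpen W)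
    {X Y : ∀ p : S.WorldlineSpace, TangentSpace (𝓡 n) p} (hX : SmoothFieldOn X W)
    (hY : SmoothFieldOn Y W) :
    ContMDiffOn (𝓡 (n + 1)) 𝓘(ℝ, ℝ) ∞ (fun x => S.pushMetric (S.time x) (S.worldline x)
      (X (S.worldline x)) (Y (S.worldline x))) (S.worldline ⁻¹' W) := by
  refine (S.g_smooth _ _ _ (hW.preimage S.continuous_worldline)
    (S.smoothFieldOn_proj_lift hW hX) (S.smoothFieldOn_proj_lift hW hY)).congr ?_
  intro x _
  exact S.pushMetric_apply (x := x) rfl _ _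

end PreSpacetime

end RicciSpacetime

end

noncomputable section

namespace RicciSpacetime

/-! ### Coordinate fields and their lifts -/

section CoordField

variable {n : ℕ} {M : Type*} [TopologicalSpace M] [ChartedSpace (EuclideanSpace ℝ (Fin n)) M]
  [IsManifold (𝓡 n) ∞ M]

/-- The vector field with constant coefficients `a` in the chart around `p`. -/
def coordField (p : M) (a : EuclideanSpace ℝ (Fin n)) (q : M) :
    TangentSpace (𝓡 n) q :=
  (mfderiv (𝓡 n) (𝓡 n) (extChartAt (𝓡 n) p) q).inverse a

theorem isInvertible_mfderiv_chart {p q : M}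
    (hq : q ∈ (extChartAt (𝓡 n) p).source) :
    (mfderiv (𝓡 n) (𝓡 n) (extChartAt (𝓡 n) p) q).IsInvertible :=
  isInvertible_mfderiv_extChartAt hq

theorem mfderiv_coordField {p q : M} (a : EuclideanSpace ℝ (Fin n))
    (hq : q ∈ (extChartAt (𝓡 n) p).source) :
    mfderiv (𝓡 n) (𝓡 n) (extChartAt (𝓡 n) p) q (coordField p a q) = a :=
  (isInvertible_mfderiv_chart hq).self_apply_inverse _

theorem coordField_mfderiv (p : M) (v : TangentSpace (𝓡 n) p) :
    coordField p (mfderiv (𝓡 n) (𝓡 n) (extChartAt (𝓡 n) p) p v) p = v :=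
  (isInvertible_mfderiv_chart (mem_extChartAt_source p)).inverse_apply_self _

theorem smoothFieldOn_coordField {M : Type u} [TopologicalSpace M]
    [ChartedSpace (EuclideanSpace ℝ (Fin n)) M] [IsManifold (𝓡 n) ∞ M] (p : M)
    (a : EuclideanSpace ℝ (Fin n)) :
    SmoothFieldOn (coordField p a) (extChartAt (𝓡 n) p).source := by
  intro q hq
  have h0 : ContMDiffAt (𝓡 n) (𝓡 n).tangent ∞
      (fun y : EuclideanSpace ℝ (Fin n) => (⟨y, a⟩ : TangentBundle (𝓡 n) _))
      (extChartAt (𝓡 n) p q) :=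
    contMDiffAt_vectorSpace_iff_contDiffAt.2 contDiffAt_const
  exact (ContMDiffAt.mpullback_vectorField_preimage h0
    (contMDiffAt_extChartAt' (n := ∞) (by rwa [extChartAt_source] at hq))
    (isInvertible_mfderiv_chart hq) (by simp)).contMDiffWithinAt

end CoordField

namespace PreSpacetime

variable {n : ℕ} {𝓜 : Type u} [TopologicalSpace 𝓜]
  [ChartedSpace (EuclideanSpace ℝ (Fin (n + 1))) 𝓜] [IsManifold (𝓡 (n + 1)) ∞ 𝓜] [T2Space 𝓜]
  {I : Set ℝ} (S : PreSpacetime n 𝓜 I)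

/-- The coordinates `(y, t)` on `𝓜` given by a chart of the space of worldlines. -/
def coords (p : S.WorldlineSpace) (z : 𝓜) : EuclideanSpace ℝ (Fin n) × ℝ :=
  (extChartAt (𝓡 n) p (S.worldline z), S.time z)

theorem contMDiffAt_coords {p : S.WorldlineSpace} {z : 𝓜}
    (hz : S.worldline z ∈ (extChartAt (𝓡 n) p).source) :
    ContMDiffAt (𝓡 (n + 1)) 𝓘(ℝ, EuclideanSpace ℝ (Fin n) × ℝ) ∞ (S.coords p) z :=
  ((contMDiffAt_extChartAt' (n := ∞) (by rwa [extChartAt_source] at hz)).comp z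
    S.contMDiff_worldline.contMDiffAt).prodMk_space S.time_smooth.contMDiffAt

theorem mfderiv_coords {p : S.WorldlineSpace} {z : 𝓜}
    (hz : S.worldline z ∈ (extChartAt (𝓡 n) p).source) (v : TangentSpace (𝓡 (n + 1)) z) :
    mfderiv (𝓡 (n + 1)) 𝓘(ℝ, EuclideanSpace ℝ (Fin n) × ℝ) (S.coords p) z v
      = (mfderiv (𝓡 n) (𝓡 n) (extChartAt (𝓡 n) p) (S.worldline z)
          (mfderiv (𝓡 (n + 1)) (𝓡 n) S.worldline z v), mvfderiv (𝓡 (n + 1)) S.time z v) := by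
  have hc := ((S.contMDiffAt_coords hz).mdifferentiableAt (by simp)).hasMFDerivAt
  have h1 := HasMFDerivAt.comp z (mdifferentiableAt_extChartAt
    (by rwa [extChartAt_source] at hz)).hasMFDerivAt (S.mdifferentiableAt_worldline z).hasMFDerivAt
  have h1' := HasMFDerivAt.comp z
    (ContinuousLinearMap.fst ℝ (EuclideanSpace ℝ (Fin n)) ℝ).hasMFDerivAt hc
  have h2 := (S.time_smooth.mdifferentiableAt (by simp) (x := z)).hasMFDerivAt
  have h2' := HasMFDerivAt.comp z
    (ContinuousLinearMap.snd ℝ (EuclideanSpace ℝ (Fin n)) ℝ).hasMFDerivAt hc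
  exact Prod.ext (DFunLike.congr_fun (hasMFDerivAt_unique h1' h1) v)
    (DFunLike.congr_fun (hasMFDerivAt_unique h2' h2) v)

theorem isInvertible_mfderiv_coords {p : S.WorldlineSpace} {z : 𝓜}
    (hz : S.worldline z ∈ (extChartAt (𝓡 n) p).source) :
    (mfderiv (𝓡 (n + 1)) 𝓘(ℝ, EuclideanSpace ℝ (Fin n) × ℝ) (S.coords p) z).IsInvertible := by
  refine isInvertible_of_injective fun v w h => ?_
  have h' := (S.mfderiv_coords hz v).symm.trans (h.trans (S.mfderiv_coords hz w))
  apply S.mfderiv_toProd_injective z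
  have h1 := (isInvertible_mfderiv_chart hz).injective (congrArg Prod.fst h')
  have h2 := congrArg Prod.snd h'
  refine (S.mfderiv_toProd z v).trans (Eq.trans ?_ (S.mfderiv_toProd z w).symm)
  exact congrArg₂ Prod.mk h1 h2

/-- Lifts of coordinate fields commute with the time vector field. -/
theorem mlieBracket_lift_coordField {p : S.WorldlineSpace} {x : 𝓜}
    (hx : S.worldline x ∈ (extChartAt (𝓡 n) p).source) (a : EuclideanSpace ℝ (Fin n)) :
    VectorField.mlieBracket (𝓡 (n + 1)) S.dt
      (fun z => (S.proj z (S.lift z (coordField p a (S.worldline z)))).1) x = 0 := by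
  let V : ∀ q : EuclideanSpace ℝ (Fin n) × ℝ,
    TangentSpace 𝓘(ℝ, EuclideanSpace ℝ (Fin n) × ℝ) q := fun _ => (0, (1 : ℝ))
  let W : ∀ q : EuclideanSpace ℝ (Fin n) × ℝ,
    TangentSpace 𝓘(ℝ, EuclideanSpace ℝ (Fin n) × ℝ) q := fun _ => (a, (0 : ℝ))
  have hnh : ∀ᶠ z in 𝓝 x, S.worldline z ∈ (extChartAt (𝓡 n) p).source :=
    S.continuous_worldline.continuousAt.preimage_mem_nhds
      ((isOpen_extChartAt_source p).mem_nhds hx)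
  have hV : S.dt =ᶠ[𝓝 x] VectorField.mpullback (𝓡 (n + 1)) 𝓘(ℝ, EuclideanSpace ℝ (Fin n) × ℝ)
      (S.coords p) V := by
    filter_upwards [hnh] with z hz
    apply (S.isInvertible_mfderiv_coords hz).injective
    refine (S.mfderiv_coords hz _).trans
      (Eq.trans ?_ ((S.isInvertible_mfderiv_coords hz).self_apply_inverse _).symm)
    rw [S.mfderiv_worldline_dt, S.dt_time, map_zero]
    rfl
  have hW : (fun z => (S.proj z (S.lift z (coordField p a (S.worldline z)))).1) =ᶠ[𝓝 x]
      VectorField.mpullback (𝓡 (n + 1)) 𝓘(ℝ, EuclideanSpace ℝ (Fin n) × ℝ) (S.coords p) W := by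
    filter_upwards [hnh] with z hz
    refine (S.proj_lift z _).trans ?_
    apply (S.isInvertible_mfderiv_coords hz).injective
    refine (S.mfderiv_coords hz _).trans
      (Eq.trans ?_ ((S.isInvertible_mfderiv_coords hz).self_apply_inverse _).symm)
    refine Prod.ext ?_ (S.mvfderiv_time_lift z _)
    refine (congrArg _ (S.mfderiv_worldline_lift z _)).trans ?_
    exact mfderiv_coordField a hz
  have hsm : ∀ c : EuclideanSpace ℝ (Fin n) × ℝ,
      MDifferentiableAt 𝓘(ℝ, EuclideanSpace ℝ (Fin n) × ℝ)
        𝓘(ℝ, EuclideanSpace ℝ (Fin n) × ℝ).tangent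
        (fun q => (⟨q, c⟩ : TangentBundle 𝓘(ℝ, EuclideanSpace ℝ (Fin n) × ℝ) _))
        (S.coords p x) := by
    intro c
    have : ContMDiffAt 𝓘(ℝ, EuclideanSpace ℝ (Fin n) × ℝ)
        𝓘(ℝ, EuclideanSpace ℝ (Fin n) × ℝ).tangent 1
        (fun q => (⟨q, c⟩ : TangentBundle 𝓘(ℝ, EuclideanSpace ℝ (Fin n) × ℝ) _))
        (S.coords p x) := contMDiffAt_vectorSpace_iff_contDiffAt.2 contDiffAt_const
    exact this.mdifferentiableAt (by simp)
  rw [hV.mlieBracket_vectorField_eq hW]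
  have : IsManifold (𝓡 (n + 1)) (minSmoothness ℝ 3) 𝓜 :=
    IsManifold.of_le (n := ∞) (by simp; exact WithTop.coe_le_coe.2 le_top)
  rw [← VectorField.mpullback_mlieBracket (hsm _) (hsm _) (S.contMDiffAt_coords hx)
    (by simp; exact WithTop.coe_le_coe.2 le_top)]
  have h0 : VectorField.mlieBracket 𝓘(ℝ, EuclideanSpace ℝ (Fin n) × ℝ) V W (S.coords p x) = 0 := by
    rw [← VectorField.mlieBracketWithin_univ, VectorField.mlieBracketWithin_eq_lieBracketWithin]
    simp [VectorField.lieBracketWithin, V, W]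
    rfl
  rw [VectorField.mpullback_apply, h0, map_zero]

end PreSpacetime

end RicciSpacetime

end

noncomputable section

namespace RicciSpacetime

section ChartSymm

variable {n : ℕ} {M : Type*} [TopologicalSpace M] [ChartedSpace (EuclideanSpace ℝ (Fin n)) M]
  [IsManifold (𝓡 n) ∞ M]

theorem mfderiv_chart_mfderiv_chart_symm {p : M} {y : EuclideanSpace ℝ (Fin n)}
    (hy : y ∈ (extChartAt (𝓡 n) p).target) (a : EuclideanSpace ℝ (Fin n)) :
    mfderiv (𝓡 n) (𝓡 n) (extChartAt (𝓡 n) p) ((extChartAt (𝓡 n) p).symm y)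
      (mfderiv (𝓡 n) (𝓡 n) (extChartAt (𝓡 n) p).symm y a) = a := by
  have h := mfderiv_extChartAt_comp_mfderivWithin_extChartAt_symm (I := 𝓡 n) hy
  rw [ModelWithCorners.range_eq_univ, mfderivWithin_univ] at h
  exact DFunLike.congr_fun h a

theorem mfderiv_chart_symm_mfderiv_chart (p : M) (v : TangentSpace (𝓡 n) p) :
    mfderiv (𝓡 n) (𝓡 n) (extChartAt (𝓡 n) p).symm (extChartAt (𝓡 n) p p)
      (mfderiv (𝓡 n) (𝓡 n) (extChartAt (𝓡 n) p) p v) = v := by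
  have h := mfderivWithin_extChartAt_symm_comp_mfderiv_extChartAt' (I := 𝓡 n)
    (mem_extChartAt_source (I := 𝓡 n) p)
  rw [ModelWithCorners.range_eq_univ, mfderivWithin_univ] at h
  exact DFunLike.congr_fun h v

end ChartSymm

namespace PreSpacetime

variable {n : ℕ} {𝓜 : Type u} [TopologicalSpace 𝓜]
  [ChartedSpace (EuclideanSpace ℝ (Fin (n + 1))) 𝓜] [IsManifold (𝓡 (n + 1)) ∞ 𝓜] [T2Space 𝓜]
  {I : Set ℝ} (S : PreSpacetime n 𝓜 I)

/-! ### Parametrizing slices by charts of the space of worldlines -/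

/-- The part of the chart around `p` whose worldlines exist at time `t`. -/
def sliceDomain (p : S.WorldlineSpace) (t : ℝ) : Set (EuclideanSpace ℝ (Fin n)) :=
  (extChartAt (𝓡 n) p).target ∩
    (extChartAt (𝓡 n) p).symm ⁻¹' ((fun q => (q, t)) ⁻¹' range S.toProd)

theorem isOpen_sliceDomain (p : S.WorldlineSpace) (t : ℝ) : IsOpen (S.sliceDomain p t) :=
  (continuousOn_extChartAt_symm p).isOpen_inter_preimage (isOpen_extChartAt_target p)
    (S.isOpen_range_toProd.preimage (by fun_prop))

variable [Nonempty 𝓜]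

/-- The parametrization of the slice at time `t` by the chart around `p`. -/
def sliceParam (p : S.WorldlineSpace) (t : ℝ) (y : EuclideanSpace ℝ (Fin n)) : 𝓜 :=
  S.ofProd ((extChartAt (𝓡 n) p).symm y, t)

variable {S} {p : S.WorldlineSpace} {t : ℝ} {y : EuclideanSpace ℝ (Fin n)}

theorem toProd_sliceParam (hy : y ∈ S.sliceDomain p t) :
    S.toProd (S.sliceParam p t y) = ((extChartAt (𝓡 n) p).symm y, t) := S.toProd_ofProd hy.2

variable (S p t) in
theorem contMDiffOn_sliceParam :
    ContMDiffOn (𝓡 n) (𝓡 (n + 1)) ∞ (S.sliceParam p t) (S.sliceDomain p t) :=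
  S.contMDiffOn_ofProd.comp
    (((contMDiffOn_extChartAt_symm p).mono inter_subset_left).prodMk contMDiffOn_const)
    fun _ hy => hy.2

theorem mfderiv_sliceParam (hy : y ∈ S.sliceDomain p t) (a : EuclideanSpace ℝ (Fin n)) :
    mfderiv (𝓡 n) (𝓡 (n + 1)) (S.sliceParam p t) y a
      = S.lift (S.sliceParam p t y) (mfderiv (𝓡 n) (𝓡 n) (extChartAt (𝓡 n) p).symm y a) := by
  have hn := (S.isOpen_sliceDomain p t).mem_nhds hy
  have hφ := (((S.contMDiffOn_sliceParam p t).contMDiffAt hn).mdifferentiableAt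
    (by simp)).hasMFDerivAt
  have h1 := HasMFDerivAt.comp y (S.mdifferentiableAt_worldline _).hasMFDerivAt hφ
  have h2 := HasMFDerivAt.comp y
    (S.time_smooth.mdifferentiableAt (by simp) (x := S.sliceParam p t y)).hasMFDerivAt hφ
  have e1 : S.worldline ∘ S.sliceParam p t =ᶠ[𝓝 y] (extChartAt (𝓡 n) p).symm := by
    filter_upwards [hn] with z hz
    exact congrArg Prod.fst (toProd_sliceParam hz)
  have e2 : S.time ∘ S.sliceParam p t =ᶠ[𝓝 y] fun _ => t := by
    filter_upwards [hn] with z hz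
    exact congrArg Prod.snd (toProd_sliceParam hz)
  have h2' := (hasMFDerivAt_const (I := 𝓡 n) (I' := 𝓘(ℝ, ℝ)) t y).congr_of_eventuallyEq e2
  refine S.eq_lift ?_ (DFunLike.congr_fun (hasMFDerivAt_unique h2 h2') a)
  exact DFunLike.congr_fun (h1.mfderiv.symm.trans e1.mfderiv_eq) a

variable (S p t) in
theorem isSliceParam_sliceParam : S.IsSliceParam t (S.sliceDomain p t) (S.sliceParam p t) where
  isOpen := S.isOpen_sliceDomain p t
  smooth := S.contMDiffOn_sliceParam p t
  mem_slice _ hy := congrArg Prod.snd (toProd_sliceParam hy)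
  immersion y hy a b hab := by
    have h := (mfderiv_sliceParam hy a).symm.trans (hab.trans (mfderiv_sliceParam hy b))
    have h1 := (S.mfderiv_worldline_lift _ _).symm.trans
      ((congrArg (mfderiv (𝓡 (n + 1)) (𝓡 n) S.worldline (S.sliceParam p t y)) h).trans
        (S.mfderiv_worldline_lift _ _))
    exact (mfderiv_chart_mfderiv_chart_symm hy.1 a).symm.trans
      ((congrArg (mfderiv (𝓡 n) (𝓡 n) (extChartAt (𝓡 n) p) ((extChartAt (𝓡 n) p).symm y)) h1).trans
        (mfderiv_chart_mfderiv_chart_symm hy.1 b))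

theorem paramCoeff_sliceParam (hy : y ∈ S.sliceDomain p t) :
    S.paramCoeff (S.sliceParam p t) y = chartCoeff (S.pushMetric t) p y := by
  ext i j
  refine Eq.trans ?_ (S.pushMetric_apply (toProd_sliceParam hy) _ _).symm
  exact congrArg₂ (S.met (S.sliceParam p t y)) (mfderiv_sliceParam hy _) (mfderiv_sliceParam hy _)

/-! ### The flow equation on the space of worldlines -/

theorem hasMFDerivAt_ofProd (hp : (p, t) ∈ range S.toProd) :
    HasMFDerivAt 𝓘(ℝ, ℝ) (𝓡 (n + 1)) (fun s => S.ofProd (p, s)) t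
      ((1 : ℝ →L[ℝ] ℝ).smulRight (S.dt (S.ofProd (p, t)))) := by
  have hsm : ContMDiffAt 𝓘(ℝ, ℝ) (𝓡 (n + 1)) ∞ (fun s => S.ofProd (p, s)) t :=
    ContMDiffAt.comp (f := fun s : ℝ => (p, s)) t (S.contMDiffAt_ofProd hp)
      (contMDiffAt_const.prodMk contMDiffAt_id)
  have hγ := (hsm.mdifferentiableAt (by simp)).hasMFDerivAt
  have h1 := HasMFDerivAt.comp (f := fun s => S.ofProd (p, s)) t
    (S.contMDiff_toProd.mdifferentiableAt (by simp)).hasMFDerivAt hγ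
  have e : (S.toProd ∘ fun s => S.ofProd (p, s)) =ᶠ[𝓝 t] fun s => (p, s) := by
    have hc : ContinuousAt (fun s : ℝ => (p, s)) t := by fun_prop
    filter_upwards [hc.preimage_mem_nhds (S.isOpen_range_toProd.mem_nhds hp)] with s hs
    exact S.toProd_ofProd hs
  have h2 := ((hasMFDerivAt_const (I := 𝓘(ℝ, ℝ)) (I' := 𝓡 n) p t).prodMk
    (hasMFDerivAt_id (I := 𝓘(ℝ, ℝ)) t)).congr_of_eventuallyEq e
  have h3 := DFunLike.congr_fun (hasMFDerivAt_unique h1 h2) (1 : ℝ)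
  let A : ℝ →L[ℝ] EuclideanSpace ℝ (Fin (n + 1)) :=
    mfderiv 𝓘(ℝ, ℝ) (𝓡 (n + 1)) (fun s => S.ofProd (p, s)) t
  have h4 : A 1 = S.dt (S.ofProd (p, t)) :=
    S.mfderiv_toProd_injective _ (h3.trans (S.mfderiv_toProd_dt _).symm)
  have h5 : A = (1 : ℝ →L[ℝ] ℝ).smulRight (A 1) := ContinuousLinearMap.ext_ring (by simp)
  rw [h4] at h5
  exact h5 ▸ hγ

theorem hasDerivAt_pushMetric (hS : S.RicciFlowEquation) (hp : (p, t) ∈ range S.toProd)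
    (v w : TangentSpace (𝓡 n) p) :
    HasDerivAt (fun s => S.pushMetric s p v w) (-2 * ricci (S.pushMetric t) p v w) t := by
  set x := S.ofProd (p, t) with hx
  have hxp : S.toProd x = (p, t) := S.toProd_ofProd hp
  have hwx : S.worldline x = p := congrArg Prod.fst hxp
  let D := mfderiv (𝓡 n) (𝓡 n) (extChartAt (𝓡 n) p) p
  let U : Set 𝓜 := S.worldline ⁻¹' (extChartAt (𝓡 n) p).source
  have hU : IsOpen U := (isOpen_extChartAt_source p).preimage S.continuous_worldline
  have hxU : S.worldline x ∈ (extChartAt (𝓡 n) p).source := by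
    rw [hwx]
    exact mem_extChartAt_source p
  let X : EuclideanSpace ℝ (Fin n) → ∀ z : 𝓜, spat n S.time z := fun a z =>
    S.proj z (S.lift z (coordField p a (S.worldline z)))
  have hX : ∀ a, SmoothFieldOn (fun z => (X a z).1) U := fun a =>
    S.smoothFieldOn_proj_lift (isOpen_extChartAt_source p) (smoothFieldOn_coordField p a)
  have hXv : ∀ (u : TangentSpace (𝓡 n) p) (z : 𝓜), S.worldline z = p →
      (X (D u) z).1 = S.lift z u := by
    intro u z hz
    refine (S.proj_lift z _).trans (congrArg (S.lift z) ?_)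
    rw [hz]
    exact coordField_mfderiv p u
  have hy : extChartAt (𝓡 n) p p ∈ S.sliceDomain p t := by
    refine ⟨mem_extChartAt_target p, ?_⟩
    change ((extChartAt (𝓡 n) p).symm (extChartAt (𝓡 n) p p), t) ∈ range S.toProd
    rwa [extChartAt_to_inv]
  have hφ : S.sliceParam p t (extChartAt (𝓡 n) p p) = x := by
    rw [sliceParam, extChartAt_to_inv]
  have hφX : ∀ u : TangentSpace (𝓡 n) p,
      mfderiv (𝓡 n) (𝓡 (n + 1)) (S.sliceParam p t) (extChartAt (𝓡 n) p p) (D u)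
        = (X (D u) (S.sliceParam p t (extChartAt (𝓡 n) p p))).1 := by
    intro u
    refine (mfderiv_sliceParam hy _).trans (Eq.trans ?_ (hXv u _ (by rw [hφ, hwx])).symm)
    exact congrArg _ (mfderiv_chart_symm_mfderiv_chart p u)
  have key := hS t _ _ (S.isSliceParam_sliceParam p t) _ hy U (X (D v)) (X (D w)) hU
    (by rw [hφ]; exact hxU) (hX _) (hX _) (D v) (D w) (hφX v) (hφX w)
  rw [hφ] at key
  have hR : ricciCoord (S.paramCoeff (S.sliceParam p t)) (extChartAt (𝓡 n) p p) (D v) (D w)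
      = ricci (S.pushMetric t) p v w :=
    ricciCoord_congr (Filter.eventually_of_mem ((S.isOpen_sliceDomain p t).mem_nhds hy)
      fun z hz => paramCoeff_sliceParam hz) _ _
  have hB : ∀ a, VectorField.mlieBracket (𝓡 (n + 1)) S.dt (fun z => (X a z).1) x = 0 := fun a =>
    S.mlieBracket_lift_coordField hxU a
  have hL : ∀ a b, S.lieDerivMetric (X a) (X b) x
      = mvfderiv (𝓡 (n + 1)) (fun z => S.g z (X a z) (X b z)) x (S.dt x) := fun a b => by
    rw [lieDerivMetric, hB, hB, met_zero_left, met_zero_right, sub_zero, sub_zero]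
  replace key := (hL (D v) (D w)).symm.trans (key.trans (congrArg (-2 * ·) hR))
  have hg : MDifferentiableAt (𝓡 (n + 1)) 𝓘(ℝ, ℝ) (fun z => S.g z (X (D v) z) (X (D w) z)) x :=
    ((S.g_smooth U _ _ hU (hX _) (hX _)).contMDiffAt (hU.mem_nhds hxU)).mdifferentiableAt (by simp)
  have hd := hasDerivAt_comp_of_hasMFDerivAt (γ := fun s => S.ofProd (p, s)) hg
    (hasMFDerivAt_ofProd hp)
  refine (hd.congr_deriv key).congr_of_eventuallyEq ?_
  have hc : ContinuousAt (fun s : ℝ => (p, s)) t := by fun_prop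
  filter_upwards [hc.preimage_mem_nhds (S.isOpen_range_toProd.mem_nhds hp)] with s hs
  have hz := S.toProd_ofProd hs
  refine (S.pushMetric_apply hz v w).trans ?_
  have hw : S.worldline (S.ofProd (p, s)) = p := congrArg Prod.fst hz
  have hY : ∀ u, S.proj _ (S.lift (S.ofProd (p, s)) u) = X (D u) (S.ofProd (p, s)) := fun u =>
    Subtype.ext ((S.proj_lift _ u).trans (hXv u _ hw).symm)
  exact congrArg₂ (fun a b => S.g (S.ofProd (p, s)) a b) (hY v) (hY w)

theorem isRicciFlowOn_pushMetric (hS : S.RicciFlowEquation) :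
    IsRicciFlowOn I (range S.toProd) S.pushMetric where
  isOpen := S.isOpen_range_toProd
  subset := by
    rintro _ ⟨x, rfl⟩
    exact ⟨mem_univ _, S.time_mem x⟩
  slice_nonempty t ht := by
    obtain ⟨x, rfl⟩ := S.time_range.superset ht
    exact ⟨S.worldline x, x, rfl⟩
  symm p t _ v w := S.g_symm _ _ _
  pos p t _ v hv := by
    refine S.g_pos _ _ fun h => hv ?_
    have h1 : S.lift (S.ofProd (p, t)) v = 0 :=
      (S.proj_lift _ v).symm.trans (congrArg Subtype.val h)
    exact (S.mfderiv_worldline_lift _ v).symm.trans ((congrArg _ h1).trans (map_zero _))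
  smooth W X Y hW hX hY := by
    have h := (S.contMDiffOn_pushMetric hW hX hY).comp
      (S.contMDiffOn_ofProd.mono (inter_subset_left (t := W ×ˢ univ))) (by
        rintro q ⟨hq, hqW⟩
        change S.worldline (S.ofProd q) ∈ W
        rw [show S.worldline (S.ofProd q) = q.1 from congrArg Prod.fst (S.toProd_ofProd hq)]
        exact hqW.1)
    refine h.congr fun q hq => ?_
    have h1 : S.worldline (S.ofProd q) = q.1 := congrArg Prod.fst (S.toProd_ofProd hq.1)
    have h2 : S.time (S.ofProd q) = q.2 := congrArg Prod.snd (S.toProd_ofProd hq.1)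
    simp only [Function.comp_apply]
    rw [h1, h2]
  flow _ _ hp v w := hasDerivAt_pushMetric hS hp v w

end PreSpacetime

end RicciSpacetime

end

theorem mainTheorem4 {n : ℕ} {𝓜 : Type u} [TopologicalSpace 𝓜]
    [ChartedSpace (EuclideanSpace ℝ (Fin (n + 1))) 𝓜] [IsManifold (𝓡 (n + 1)) ∞ 𝓜]
    [T2Space 𝓜] [SecondCountableTopology 𝓜] [ConnectedSpace 𝓜] {T : EReal}
    (S : RicciSpacetime.RicciFlowSpacetime n 𝓜 (RicciSpacetime.timeInterval T))
    (hS : RicciSpacetime.IsExpanding S) :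
    ∃ (M : Type u) (_ : TopologicalSpace M) (_ : ChartedSpace (EuclideanSpace ℝ (Fin n)) M)
      (_ : IsManifold (𝓡 n) ∞ M) (_ : T2Space M) (_ : SecondCountableTopology M)
      (_ : ConnectedSpace M) (Φ : 𝓜 → M × ℝ)
      (h : ℝ → ∀ p : M, LinearMap.BilinForm ℝ (TangentSpace (𝓡 n) p)),
      -- `Φ` maps into `M × (0, T)` and is a diffeomorphism onto its (open) image
      (∀ x, (Φ x).2 ∈ RicciSpacetime.timeInterval T) ∧
      RicciSpacetime.IsDiffeoOntoOpenImageOn (𝓡 (n + 1)) ((𝓡 n).prod 𝓘(ℝ, ℝ)) univ Φ ∧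
      -- each slice is mapped diffeomorphically onto its (open) image in `M × {t} = M`
      (∀ t ∈ RicciSpacetime.timeInterval T,
        RicciSpacetime.IsDiffeoOntoOpenImageOn (𝓡 (n + 1)) (𝓡 n) (S.slice t)
          (fun x => (Φ x).1)) ∧
      -- `𝔱 = t ∘ Φ` and `Φ_* ∂_t = ∂/∂t`
      (∀ x, (Φ x).2 = S.time x) ∧
      (∀ x, mfderiv (𝓡 (n + 1)) ((𝓡 n).prod 𝓘(ℝ, ℝ)) Φ x (S.dt x)
        = ((0 : EuclideanSpace ℝ (Fin n)), (1 : ℝ))) ∧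
      -- `h = Φ_* g` is a solution of the Ricci flow equation on `Φ(𝓜)`
      (∀ (x : 𝓜) (v w : RicciSpacetime.spat n S.time x),
        h (S.time x) (Φ x).1
          (mfderiv (𝓡 (n + 1)) (𝓡 n) (fun z => (Φ z).1) x v.1)
          (mfderiv (𝓡 (n + 1)) (𝓡 n) (fun z => (Φ z).1) x w.1) = S.g x v w) ∧
      RicciSpacetime.IsRicciFlowOn (RicciSpacetime.timeInterval T) (range Φ) h ∧
      -- `M` is the direct limit of the slices along the flow of `∂_t`: the union of their images,
      -- two points having the same image exactly when they lie on a common worldline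
      (∀ p : M, ∃ x, (Φ x).1 = p) ∧
      (∀ x y, (Φ x).1 = (Φ y).1 ↔ ∃ t, S.WorldlineAt x t y) := by
  have := hS.t2Space
  have := S.secondCountableTopology_worldlineSpace
  have := S.connectedSpace_worldlineSpace
  exact ⟨S.WorldlineSpace, inferInstance, inferInstance, inferInstance, inferInstance,
    inferInstance, inferInstance, S.toProd, S.pushMetric, S.time_mem, S.isDiffeo_toProd,
    fun t _ => S.isDiffeo_worldline_slice t, fun _ => rfl, S.mfderiv_toProd_dt,
    S.pushMetric_mfderiv, RicciSpacetime.PreSpacetime.isRicciFlowOn_pushMetric S.ricciFlow,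
    S.worldline_surjective, fun _ _ => S.worldline_eq_iff⟩
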